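/- Setting. Let $d_\theta,d_x\ge 0$ be integers and let $U:\mathbb{R}^{d_\theta}\times\mathbb{R}^{d_x}\to\mathbb{R}$ be differentiable; write $v=(\theta,x)$, with Euclidean norms throughout. Assume (A1) there are $L_\theta,L_x>0$ with $\|\nabla U(v)-\nabla U(v')\|\le L_\theta\|\theta-\theta'\|+L_x\|x-x'\|$ for all $v=(\theta,x)$, $v'=(\theta',x')$; let $L>0$ be an overall Lipschitz constant of $\nabla U$, i.e. $\|\nabla U(v)-\nabla U(v')\|\le L\|v-v'\|$ for all $v,v'$; (A2) there is $\mu>0$ with $\langle v-v',\nabla U(v)-\nabla U(v')\rangle\ge\mu\|v-v'\|^2$ for all $v,v'$. Let $v^\star=(\theta^\star,x^\star)$ be the minimiser of $U$. For $N\ge 1$ let $\boldsymbol{B}^0$ (in $\mathbb{R}^{d_\theta}$) and $\boldsymbol{B}^1,\dots,\boldsymbol{B}^N$ (in $\mathbb{R}^{d_x}$) be independent standard Brownian motions, and let the initial condition $(\theta_0,X_0^1,\dots,X_0^N)$ be square integrable and independent of them (for instance deterministic). Let $(\boldsymbol{\theta}_t,\boldsymbol{X}_t^1,\dots,\boldsymbol{X}_t^N)_{t\ge0}$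 be the continuous solution, started at $(\theta_0,X_0^1,\dots,X_0^N)$, of $$\mathrm{d}\boldsymbol{\theta}_t=-\frac1N\sum_{j=1}^N\nabla_\theta U(\boldsymbol{\theta}_t,\boldsymbol{X}_t^j)\,\mathrm{d}t+\sqrt{\tfrac2N}\,\mathrm{d}\boldsymbol{B}_t^0,\qquad \mathrm{d}\boldsymbol{X}_t^i=-\nabla_xU(\boldsymbol{\theta}_t,\boldsymbol{X}_t^i)\,\mathrm{d}t+\sqrt2\,\mathrm{d}\boldsymbol{B}_t^i,$$ and, for a step size $\gamma>0$, let $(\theta_n,X_n^1,\dots,X_n^N)_{n\ge0}$ be the Euler–Maruyama scheme from the same initial condition with the same Brownian motions, $$\theta_{n+1}=\theta_n-\frac{\gamma}{N}\sum_{j=1}^N\nabla_\theta U(\theta_n,X_n^j)+\sqrt{\tfrac{2\gamma}{N}}\,\xi^0_{n+1},\qquad X_{n+1}^i=X_n^i-\gamma\nabla_xU(\theta_n,X_n^i)+\sqrt{2\gamma}\,\xi^i_{n+1},$$ where $\xi^i_{n+1}=\gamma^{-1/2}\big(\boldsymbol{B}^i_{(n+1)\gamma}-\boldsymbol{B}^i_{n\gamma}\big)$.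 Claim. For every $\gamma_0\in(0,\min\{L^{-1},2\mu^{-1}\})$ and every $R$ there is a constant $C_1>0$, depending only on $L,\mu,\gamma_0,R$ (in particular not on $n$, $N$, $\gamma$, $d_\theta$, $d_x$), such that whenever $$\mathbb{E}\Big[\|\theta_0-\theta^\star\|^2+\frac1N\sum_{i=1}^N\|X_0^i-x^\star\|^2\Big]\le R,$$ one has, for every $\gamma\in(0,\gamma_0)$ and every $n\in\mathbb{N}$, that $\|\theta_n-\boldsymbol{\theta}_{n\gamma}\|^2$ is integrable and $$\mathbb{E}\big[\|\theta_n-\boldsymbol{\theta}_{n\gamma}\|^2\big]^{1/2}\le C_1\Big(1+\sqrt{d_\theta/N+d_x}\Big)\gamma^{1/2}.$$ -/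

import Mathlib

open MeasureTheory ProbabilityTheory
open scoped NNReal

namespace IPLA

/-- Euclidean space `ℝᵈ` with its Euclidean norm. -/
abbrev Euc (d : ℕ) : Type := EuclideanSpace ℝ (Fin d)

/-- The space `ℝ^{dθ} × ℝ^{dx}` of pairs `v = (θ, x)`, with the Euclidean norm
`‖v‖² = ‖θ‖² + ‖x‖²`. -/
abbrev Joint (dθ dx : ℕ) : Type := WithLp 2 (Euc dθ × Euc dx)

variable {dθ dx N : ℕ}

/-- The partial gradient `∇_θ U(θ, x)`: the `θ`-block of `∇U(θ, x)`. -/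
noncomputable def gradTheta (U : Joint dθ dx → ℝ) (θ : Euc dθ) (x : Euc dx) : Euc dθ :=
  (gradient U (WithLp.toLp 2 (θ, x))).fst

/-- The partial gradient `∇_x U(θ, x)`: the `x`-block of `∇U(θ, x)`. -/
noncomputable def gradX (U : Joint dθ dx → ℝ) (θ : Euc dθ) (x : Euc dx) : Euc dx :=
  (gradient U (WithLp.toLp 2 (θ, x))).snd

/-- `∇U` is Lipschitz in both variables, with constants `Lθ` and `Lx`. -/
def LipschitzInBoth (U : Joint dθ dx → ℝ) (Lθ Lx : ℝ) : Prop :=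
  ∀ v v' : Joint dθ dx,
    ‖gradient U v - gradient U v'‖ ≤ Lθ * ‖v.fst - v'.fst‖ + Lx * ‖v.snd - v'.snd‖

/-- `∇U` is Lipschitz with overall constant `L`. -/
def OverallLipschitz (U : Joint dθ dx → ℝ) (L : ℝ) : Prop :=
  ∀ v v' : Joint dθ dx, ‖gradient U v - gradient U v'‖ ≤ L * ‖v - v'‖

/-- Strong convexity, as strong monotonicity of `∇U` with constant `μ`. -/
def StronglyMonotone (U : Joint dθ dx → ℝ) (μ : ℝ) : Prop :=
  ∀ v v' : Joint dθ dx, μ * ‖v - v'‖ ^ 2 ≤ inner ℝ (v - v') (gradient U v - gradient U v')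

section Dynamics

variable {Ω : Type*} [MeasurableSpace Ω]

/-- A standard `d`-dimensional Brownian motion: its coordinates are independent real
Brownian motions. -/
structure IsBrownian {d : ℕ} (B : ℝ≥0 → Ω → Euc d) (P : Measure Ω) : Prop where
  coord : ∀ k : Fin d, IsBrownianReal (fun t ω ↦ B t ω k) P
  indep : iIndepFun (fun (k : Fin d) ω (t : ℝ≥0) ↦ B t ω k) P

/-- The driving noise: `B0` (in `ℝ^{dθ}`) and `B 1, …, B N` (in `ℝ^{dx}`) are standard Brownian
motions, and the `N + 1` processes are independent. -/
structure IsNoise (B0 : ℝ≥0 → Ω → Euc dθ) (B : Fin N → ℝ≥0 → Ω → Euc dx)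
    (P : Measure Ω) : Prop where
  theta : IsBrownian B0 P
  particle : ∀ i, IsBrownian (B i) P
  indep_particles : iIndepFun (fun (i : Fin N) ω (t : ℝ≥0) ↦ B i t ω) P
  indep_theta : IndepFun (fun ω (t : ℝ≥0) ↦ B0 t ω) (fun ω (i : Fin N) (t : ℝ≥0) ↦ B i t ω) P

/-- The initial condition is square integrable and independent of the driving noise. -/
structure IsInitial (θ0 : Ω → Euc dθ) (X0 : Fin N → Ω → Euc dx)
    (B0 : ℝ≥0 → Ω → Euc dθ) (B : Fin N → ℝ≥0 → Ω → Euc dx) (P : Measure Ω) : Prop where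
  theta : MemLp θ0 2 P
  particle : ∀ i, MemLp (X0 i) 2 P
  indep : IndepFun (fun ω ↦ (θ0 ω, fun i : Fin N ↦ X0 i ω))
    (fun ω ↦ (fun t : ℝ≥0 ↦ B0 t ω, fun (i : Fin N) (t : ℝ≥0) ↦ B i t ω)) P

/-- `(θ, X¹, …, Xᴺ)` is a solution of the interacting particle system
`dθ_t = -(1/N) ∑ⱼ ∇_θ U(θ_t, Xʲ_t) dt + √(2/N) dB⁰_t`,
`dXⁱ_t = -∇_x U(θ_t, Xⁱ_t) dt + √2 dBⁱ_t`
started at `(θ0, X0)`. The diffusion coefficients are constant, so that the stochastic integrals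
are multiples of the Brownian motions. -/
structure IsSolution (U : Joint dθ dx → ℝ) (θ0 : Ω → Euc dθ) (X0 : Fin N → Ω → Euc dx)
    (B0 : ℝ≥0 → Ω → Euc dθ) (B : Fin N → ℝ≥0 → Ω → Euc dx) (P : Measure Ω)
    (θ : ℝ≥0 → Ω → Euc dθ) (X : Fin N → ℝ≥0 → Ω → Euc dx) : Prop where
  aemeasurable_theta : ∀ t, AEMeasurable (θ t) P
  aemeasurable_particle : ∀ i t, AEMeasurable (X i t) P
  continuous_theta : ∀ᵐ ω ∂P, Continuous (fun t ↦ θ t ω)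
  continuous_particle : ∀ i, ∀ᵐ ω ∂P, Continuous (fun t ↦ X i t ω)
  eq_theta : ∀ᵐ ω ∂P, ∀ t : ℝ≥0,
    θ t ω = θ0 ω
      - (∫ s in (0 : ℝ)..t,
          (1 / (N : ℝ)) • ∑ j, gradTheta U (θ s.toNNReal ω) (X j s.toNNReal ω))
      + √(2 / (N : ℝ)) • B0 t ω
  eq_particle : ∀ i, ∀ᵐ ω ∂P, ∀ t : ℝ≥0,
    X i t ω = X0 i ω
      - (∫ s in (0 : ℝ)..t, gradX U (θ s.toNNReal ω) (X i s.toNNReal ω))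
      + √2 • B i t ω

/-- The standard Gaussian `ξ_{n+1} = γ^{-1/2} (B_{(n+1)γ} - B_{nγ})`. -/
noncomputable def xi {d : ℕ} (B : ℝ≥0 → Ω → Euc d) (γ : ℝ≥0) (n : ℕ) (ω : Ω) : Euc d :=
  (√(γ : ℝ))⁻¹ • (B (((n : ℝ≥0) + 1) * γ) ω - B ((n : ℝ≥0) * γ) ω)

/-- The Euler–Maruyama scheme `n ↦ (θ_n, (X¹_n, …, Xᴺ_n))` with step size `γ`, driven by the same
Brownian motions and started at the same initial condition as the particle system. -/
noncomputable def scheme (U : Joint dθ dx → ℝ) (θ0 : Ω → Euc dθ) (X0 : Fin N → Ω → Euc dx)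
    (B0 : ℝ≥0 → Ω → Euc dθ) (B : Fin N → ℝ≥0 → Ω → Euc dx) (γ : ℝ≥0) :
    ℕ → Ω → Euc dθ × (Fin N → Euc dx)
  | 0, ω => (θ0 ω, fun i ↦ X0 i ω)
  | n + 1, ω =>
    let θn := (scheme U θ0 X0 B0 B γ n ω).1
    let Xn := (scheme U θ0 X0 B0 B γ n ω).2
    (θn - ((γ : ℝ) / N) • ∑ j, gradTheta U θn (Xn j) + √(2 * γ / N) • xi B0 γ n ω,
      fun i ↦ Xn i - (γ : ℝ) • gradX U θn (Xn i) + √(2 * γ) • xi (B i) γ n ω)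

end Dynamics

end IPLA

/-! Give the state `(θ, X¹, …, Xᴺ)` the squared norm `‖θ‖² + N⁻¹ ∑ ‖Xⁱ‖²`, by scaling each particle
with `N^{-1/2}`. The system becomes one equation `dZ = -A(Z) dt + dW` with additive noise. Pairings
with `A` are averages over `j` of pairings with `∇U` at `(θ, Xʲ)` (`inner_cloud`), so `A` inherits
`μ`-strong monotonicity and `1 / L`-cocoercivity from `∇U` with no loss in `N`. Cocoercivity of `∇U`
is Baillon–Haddad. The noise increments have `L²` norm `σ √(t - s)` with `σ² = 2 (dθ / N + dx)`,
which is the only source of dimension dependence.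

Two facts about this abstract equation finish the argument. By `eLpNorm_sub_const_le`, `‖Z_t - z‖`
is bounded in `L²` uniformly in time. Subtracting the noise leaves a random ODE, and a Lyapunov
estimate over unit time windows yields a contracting recursion. By `eLpNorm_euler_sub_le`, the error
satisfies `e_{n+1} ≤ (1 - μγ/2) e_n + O(γ^{3/2})`: an explicit Euler step contracts, and the local
error comes from the `L²` modulus of continuity of `Z`. The fixed point of this recursion is
`O(√γ)`.

The noise enters only through path continuity and the `L²` size of its increments, so pathwise
bounds and Minkowski's inequality replace Itô calculus. -/

section Cocoercivity

/-! ### Convex functions with Lipschitz gradient. -/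

variable {E : Type*} [NormedAddCommGroup E] [InnerProductSpace ℝ E] [CompleteSpace E]

lemma hasDerivAt_comp_segment {f : E → ℝ} (hf : Differentiable ℝ f) (x d : E) (t : ℝ) :
    HasDerivAt (fun t : ℝ ↦ f (x + t • d)) (inner ℝ (gradient f (x + t • d)) d) t := by
  have h1 := (hf (x + t • d)).hasGradientAt.hasFDerivAt
  have h2 : HasDerivAt (fun t : ℝ ↦ x + t • d) d t := by
    simpa using ((hasDerivAt_id t).smul_const d).const_add x
  exact (h1.comp_hasDerivAt t h2).congr_deriv (by simp [gradient])

/-- The descent lemma for a function with `L`-Lipschitz gradient. -/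
lemma le_add_inner_gradient_add_sq {f : E → ℝ} {L : ℝ} (hf : Differentiable ℝ f)
    (hL : ∀ v w, ‖gradient f v - gradient f w‖ ≤ L * ‖v - w‖) (x y : E) :
    f y ≤ f x + inner ℝ (gradient f x) (y - x) + L / 2 * ‖y - x‖ ^ 2 := by
  set d := y - x with hd
  have hder : ∀ t : ℝ, HasDerivAt
      (fun t : ℝ ↦ f (x + t • d) - t * inner ℝ (gradient f x) d - L / 2 * ‖d‖ ^ 2 * t ^ 2)
      (inner ℝ (gradient f (x + t • d)) d - inner ℝ (gradient f x) d
        - L / 2 * ‖d‖ ^ 2 * (2 * t)) t := fun t ↦ by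
    exact (((hasDerivAt_comp_segment hf x d t).sub
      ((hasDerivAt_id t).mul_const (inner ℝ (gradient f x) d))).sub
      ((hasDerivAt_pow 2 t).const_mul (L / 2 * ‖d‖ ^ 2))).congr_deriv (by norm_num)
  have hanti := antitoneOn_of_deriv_nonpos (convex_Icc (0 : ℝ) 1)
    (fun t _ ↦ (hder t).continuousAt.continuousWithinAt)
    (fun t _ ↦ (hder t).differentiableAt.differentiableWithinAt)
    (fun t ht ↦ by
      rw [interior_Icc] at ht
      rw [(hder t).deriv, ← inner_sub_left]
      have h1 := real_inner_le_norm (gradient f (x + t • d) - gradient f x) d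
      have h2 := hL (x + t • d) x
      rw [add_sub_cancel_left, norm_smul, Real.norm_of_nonneg ht.1.le] at h2
      nlinarith [mul_le_mul_of_nonneg_right h2 (norm_nonneg d)])
  have := hanti (Set.left_mem_Icc.2 zero_le_one) (Set.right_mem_Icc.2 zero_le_one) zero_le_one
  simp only [zero_smul, one_smul, add_zero, zero_mul, one_mul, hd, add_sub_cancel] at this
  linarith

/-- The first-order characterisation of convexity. -/
lemma add_inner_gradient_le {f : E → ℝ} (hf : Differentiable ℝ f)
    (hm : ∀ v w, 0 ≤ inner ℝ (v - w) (gradient f v - gradient f w)) (x y : E) :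
    f x + inner ℝ (gradient f x) (y - x) ≤ f y := by
  set d := y - x with hd
  have hder : ∀ t : ℝ, HasDerivAt
      (fun t : ℝ ↦ f (x + t • d) - t * inner ℝ (gradient f x) d)
      (inner ℝ (gradient f (x + t • d)) d - inner ℝ (gradient f x) d) t := fun t ↦ by
    exact ((hasDerivAt_comp_segment hf x d t).sub
      ((hasDerivAt_id t).mul_const (inner ℝ (gradient f x) d))).congr_deriv (by simp)
  have hmono := monotoneOn_of_deriv_nonneg (convex_Icc (0 : ℝ) 1)
    (fun t _ ↦ (hder t).continuousAt.continuousWithinAt)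
    (fun t _ ↦ (hder t).differentiableAt.differentiableWithinAt)
    (fun t ht ↦ by
      rw [interior_Icc] at ht
      rw [(hder t).deriv, ← inner_sub_left]
      have h2 := hm (x + t • d) x
      rw [add_sub_cancel_left, real_inner_smul_left, real_inner_comm] at h2
      exact nonneg_of_mul_nonneg_right h2 ht.1)
  have := hmono (Set.left_mem_Icc.2 zero_le_one) (Set.right_mem_Icc.2 zero_le_one) zero_le_one
  simp only [zero_smul, one_smul, add_zero, zero_mul, one_mul, hd, add_sub_cancel] at this
  linarith

/-- The Baillon–Haddad theorem: the `L`-Lipschitz gradient of a convex function is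
`1 / L`-cocoercive. -/
theorem gradient_cocoercive {f : E → ℝ} {L : ℝ} (hL0 : 0 < L) (hf : Differentiable ℝ f)
    (hL : ∀ v w, ‖gradient f v - gradient f w‖ ≤ L * ‖v - w‖)
    (hm : ∀ v w, 0 ≤ inner ℝ (v - w) (gradient f v - gradient f w)) (x y : E) :
    ‖gradient f x - gradient f y‖ ^ 2 ≤ L * inner ℝ (x - y) (gradient f x - gradient f y) := by
  have key : ∀ x y : E, f x + inner ℝ (gradient f x) (y - x) ≤
      f y - L⁻¹ / 2 * ‖gradient f y - gradient f x‖ ^ 2 := fun x y ↦ by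
    set g := gradient f y - gradient f x with hg
    -- The test point is a step of length `1 / L` from `y` along `-g`, the minimiser of the
    -- quadratic upper bound for `f` minus its linearisation at `x`. Convexity bounds `f` there from
    -- below, the descent lemma from above.
    have h1 := add_inner_gradient_le hf hm x (y - L⁻¹ • g)
    have h2 := le_add_inner_gradient_add_sq hf hL y (y - L⁻¹ • g)
    have h3 : inner ℝ (gradient f y) g - inner ℝ (gradient f x) g = ‖g‖ ^ 2 := by
      rw [← inner_sub_left, ← hg, real_inner_self_eq_norm_sq]
    have e1 : y - L⁻¹ • g - x = (y - x) - L⁻¹ • g := by abel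
    have e2 : y - L⁻¹ • g - y = - (L⁻¹ • g) := by abel
    rw [e1, inner_sub_right, real_inner_smul_right] at h1
    rw [e2, inner_neg_right, real_inner_smul_right, norm_neg, norm_smul, mul_pow,
      Real.norm_of_nonneg (inv_nonneg.2 hL0.le)] at h2
    have e3 : L / 2 * (L⁻¹ ^ 2 * ‖g‖ ^ 2) = L⁻¹ / 2 * ‖g‖ ^ 2 := by field_simp
    have e4 : L⁻¹ * inner ℝ (gradient f y) g - L⁻¹ * inner ℝ (gradient f x) g
      = L⁻¹ * ‖g‖ ^ 2 := by rw [← mul_sub, h3]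
    linarith
  have h1 := key x y
  have h2 := key y x
  rw [norm_sub_rev] at h1
  have h3 : inner ℝ (x - y) (gradient f x - gradient f y) =
      - inner ℝ (gradient f x) (y - x) - inner ℝ (gradient f y) (x - y) := by
    rw [real_inner_comm, inner_sub_left, ← inner_neg_right, neg_sub]
  have h4 : L⁻¹ * ‖gradient f x - gradient f y‖ ^ 2 ≤
      inner ℝ (x - y) (gradient f x - gradient f y) := by rw [h3]; linarith
  calc _ = L * (L⁻¹ * ‖gradient f x - gradient f y‖ ^ 2) := by field_simp
    _ ≤ _ := by gcongr

end Cocoercivity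

/-! ### Measurability and `L²` bounds for time integrals of continuous processes. -/

section ProcessIntegrals

open Filter Topology

variable {Ω : Type*} [MeasurableSpace Ω] {P : Measure Ω}
  {E : Type*} [NormedAddCommGroup E]

lemma tendsto_floor_mul_div (x : ℝ) :
    Tendsto (fun n : ℕ ↦ (⌊((n : ℝ) + 1) * x⌋ : ℝ) / ((n : ℝ) + 1)) atTop (𝓝 x) := by
  have h0 : Tendsto (fun n : ℕ ↦ x - 1 / ((n : ℝ) + 1)) atTop (𝓝 x) := by
    simpa using tendsto_one_div_add_atTop_nhds_zero_nat.const_sub x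
  refine tendsto_of_tendsto_of_tendsto_of_le_of_le h0 tendsto_const_nhds (fun n ↦ ?_) (fun n ↦ ?_)
  · have hn : (0 : ℝ) < (n : ℝ) + 1 := by positivity
    have := Int.sub_one_lt_floor (((n : ℝ) + 1) * x)
    simp only
    rw [le_div_iff₀ hn, sub_mul, div_mul_cancel₀ _ hn.ne']
    linarith
  · have hn : (0 : ℝ) < (n : ℝ) + 1 := by positivity
    rw [div_le_iff₀ hn, mul_comm x]
    exact Int.floor_le _

/-- A process with almost surely continuous paths is jointly almost everywhere strongly
measurable. -/
lemma aestronglyMeasurable_uncurry_of_ae_continuous [SFinite P] {g : ℝ → Ω → E}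
    (hg : ∀ s, AEStronglyMeasurable (g s) P) (hc : ∀ᵐ ω ∂P, Continuous fun s ↦ g s ω)
    (ν : Measure ℝ) [SFinite ν] :
    AEStronglyMeasurable (fun p : ℝ × Ω ↦ g p.1 p.2) (ν.prod P) := by
  refine aestronglyMeasurable_of_tendsto_ae atTop
    (f := fun (n : ℕ) (p : ℝ × Ω) ↦ g ((⌊((n : ℝ) + 1) * p.1⌋ : ℝ) / ((n : ℝ) + 1)) p.2)
    (fun n ↦ ?_) ?_
  -- The process frozen at grid times is, on each of countably many time strips, a function of `ω`
  -- alone.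
  · have hcover : (⋃ k : ℤ, {p : ℝ × Ω | ⌊((n : ℝ) + 1) * p.1⌋ = k}) = Set.univ := by
      ext p; simp
    rw [← Measure.restrict_univ (μ := ν.prod P), ← hcover, aestronglyMeasurable_iUnion_iff]
    intro k
    have hmeas : MeasurableSet {p : ℝ × Ω | ⌊((n : ℝ) + 1) * p.1⌋ = k} :=
      (Int.measurable_floor.comp (measurable_fst.const_mul _)) (measurableSet_singleton k)
    refine AEStronglyMeasurable.congr
      ((hg ((k : ℝ) / ((n : ℝ) + 1))).comp_snd (μ := ν)).restrict ?_
    filter_upwards [ae_restrict_mem hmeas] with p hp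
    have hp' : ⌊((n : ℝ) + 1) * p.1⌋ = k := hp
    simp only [hp']
  · have : ∀ᵐ p : ℝ × Ω ∂(ν.prod P), Continuous fun s ↦ g s p.2 :=
      Measure.quasiMeasurePreserving_snd.ae hc
    filter_upwards [this] with p hp
    exact (hp.tendsto p.1).comp (tendsto_floor_mul_div p.1)

lemma eLpNorm_two_le_ofReal_iff {f : Ω → E} {c : ℝ} (hc : 0 ≤ c) :
    eLpNorm f 2 P ≤ ENNReal.ofReal c ↔ ∫⁻ ω, ‖f ω‖ₑ ^ 2 ∂P ≤ ENNReal.ofReal (c ^ 2) := by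
  have h := eLpNorm_nnreal_pow_eq_lintegral (μ := P) (f := f) (p := 2) two_ne_zero
  simp only [NNReal.coe_ofNat, ENNReal.rpow_ofNat, ENNReal.coe_ofNat] at h
  rw [← h, ENNReal.ofReal_pow hc, ENNReal.pow_le_pow_left_iff two_ne_zero]

lemma norm_intervalIntegral_le_sqrt_mul_sqrt [NormedSpace ℝ E] {g : ℝ → E} (hg : Continuous g)
    {a b : ℝ} (hab : a ≤ b) :
    ‖∫ s in a..b, g s‖ ≤ √(b - a) * √(∫ s in a..b, ‖g s‖ ^ 2) := by
  rcases hab.eq_or_lt with rfl | hlt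
  · simp
  have hpos : 0 < b - a := sub_pos.2 hlt
  refine (intervalIntegral.norm_integral_le_integral_norm hab).trans ?_
  set I := ∫ s in a..b, ‖g s‖ with hI
  -- Cauchy–Schwarz as nonnegativity of the variance of `‖g‖` about its mean `I / (b - a)`.
  have h0 : 0 ≤ ∫ s in a..b, (‖g s‖ - I / (b - a)) ^ 2 :=
    intervalIntegral.integral_nonneg hab fun _ _ ↦ sq_nonneg _
  have h1 : ∫ s in a..b, (‖g s‖ - I / (b - a)) ^ 2
      = (∫ s in a..b, ‖g s‖ ^ 2) - 2 * (I / (b - a)) * I + (b - a) * (I / (b - a)) ^ 2 := by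
    have : ∀ s, (‖g s‖ - I / (b - a)) ^ 2
        = ‖g s‖ ^ 2 - 2 * (I / (b - a)) * ‖g s‖ + (I / (b - a)) ^ 2 := fun s ↦ by ring
    simp_rw [this]
    rw [intervalIntegral.integral_add, intervalIntegral.integral_sub,
      intervalIntegral.integral_const_mul, intervalIntegral.integral_const, smul_eq_mul, ← hI]
    all_goals exact Continuous.intervalIntegrable (by fun_prop) _ _
  rw [← Real.sqrt_mul hpos.le]
  refine Real.le_sqrt_of_sq_le ?_
  have h2 : 2 * (I / (b - a)) * I - (b - a) * (I / (b - a)) ^ 2 = I ^ 2 / (b - a) := by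
    field_simp; ring
  have h3 : I ^ 2 / (b - a) ≤ ∫ s in a..b, ‖g s‖ ^ 2 := by linarith
  rwa [div_le_iff₀' hpos] at h3

variable [SFinite P] {g : ℝ → Ω → E}

lemma aestronglyMeasurable_intervalIntegral [NormedSpace ℝ E]
    (hg : ∀ s, AEStronglyMeasurable (g s) P) (hc : ∀ᵐ ω ∂P, Continuous fun s ↦ g s ω)
    {a b : ℝ} (hab : a ≤ b) :
    AEStronglyMeasurable (fun ω ↦ ∫ s in a..b, g s ω) P := by
  simp_rw [intervalIntegral.integral_of_le hab]
  exact (aestronglyMeasurable_uncurry_of_ae_continuous hg hc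
    (volume.restrict (Set.Ioc a b))).prod_swap.integral_prod_right'

lemma aestronglyMeasurable_sqrt_intervalIntegral_sq
    (hg : ∀ s, AEStronglyMeasurable (g s) P) (hc : ∀ᵐ ω ∂P, Continuous fun s ↦ g s ω)
    {a b : ℝ} (hab : a ≤ b) :
    AEStronglyMeasurable (fun ω ↦ √(∫ s in a..b, ‖g s ω‖ ^ 2)) P :=
  Real.continuous_sqrt.comp_aestronglyMeasurable
    (aestronglyMeasurable_intervalIntegral (fun s ↦ (hg s).norm.pow 2)
      (by filter_upwards [hc] with ω h using h.norm.pow 2) hab)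

/-- Tonelli exchanges the time integral with the expectation of the square. -/
lemma eLpNorm_sqrt_intervalIntegral_sq_le
    (hg : ∀ s, AEStronglyMeasurable (g s) P) (hc : ∀ᵐ ω ∂P, Continuous fun s ↦ g s ω)
    {a b K : ℝ} (hab : a ≤ b) (hK : 0 ≤ K)
    (hb : ∀ s ∈ Set.Icc a b, eLpNorm (g s) 2 P ≤ ENNReal.ofReal K) :
    eLpNorm (fun ω ↦ √(∫ s in a..b, ‖g s ω‖ ^ 2)) 2 P ≤ ENNReal.ofReal (√(b - a) * K) := by
  rw [eLpNorm_two_le_ofReal_iff (by positivity), mul_pow, Real.sq_sqrt (sub_nonneg.2 hab)]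
  have h1 : ∀ᵐ ω ∂P, ‖√(∫ s in a..b, ‖g s ω‖ ^ 2)‖ₑ ^ 2
      = ∫⁻ s in Set.Ioc a b, ‖g s ω‖ₑ ^ 2 := by
    filter_upwards [hc] with ω hω
    have hnn : 0 ≤ ∫ s in a..b, ‖g s ω‖ ^ 2 :=
      intervalIntegral.integral_nonneg hab fun _ _ ↦ sq_nonneg _
    rw [Real.enorm_of_nonneg (Real.sqrt_nonneg _), ← ENNReal.ofReal_pow (Real.sqrt_nonneg _),
      Real.sq_sqrt hnn, intervalIntegral.integral_of_le hab,
      ofReal_integral_eq_lintegral_ofReal]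
    · refine lintegral_congr fun s ↦ ?_
      rw [ENNReal.ofReal_pow (norm_nonneg _), ofReal_norm]
    · exact (Continuous.integrableOn_Icc (by fun_prop)).mono_set Set.Ioc_subset_Icc_self
    · exact ae_of_all _ fun _ ↦ sq_nonneg _
  rw [lintegral_congr_ae h1, lintegral_lintegral_swap]
  · calc ∫⁻ s in Set.Ioc a b, ∫⁻ ω, ‖g s ω‖ₑ ^ 2 ∂P
        ≤ ∫⁻ _ in Set.Ioc a b, ENNReal.ofReal (K ^ 2) := by
          refine setLIntegral_mono measurable_const fun s hs ↦ ?_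
          exact (eLpNorm_two_le_ofReal_iff hK).1 (hb s (Set.Ioc_subset_Icc_self hs))
      _ = ENNReal.ofReal ((b - a) * K ^ 2) := by
          rw [setLIntegral_const, Real.volume_Ioc, mul_comm, ENNReal.ofReal_mul
            (sub_nonneg.2 hab)]
  · exact ((aestronglyMeasurable_uncurry_of_ae_continuous hg hc
      (volume.restrict (Set.Ioc a b))).prod_swap.enorm.pow_const 2)

/-- Minkowski's integral inequality in `L²`, for a process with almost surely continuous paths. -/
lemma eLpNorm_intervalIntegral_le [NormedSpace ℝ E]
    (hg : ∀ s, AEStronglyMeasurable (g s) P) (hc : ∀ᵐ ω ∂P, Continuous fun s ↦ g s ω)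
    {a b K : ℝ} (hab : a ≤ b) (hK : 0 ≤ K)
    (hb : ∀ s ∈ Set.Icc a b, eLpNorm (g s) 2 P ≤ ENNReal.ofReal K) :
    eLpNorm (fun ω ↦ ∫ s in a..b, g s ω) 2 P ≤ ENNReal.ofReal ((b - a) * K) := by
  have h1 : eLpNorm (fun ω ↦ ∫ s in a..b, g s ω) 2 P
      ≤ ENNReal.ofReal √(b - a) * eLpNorm (fun ω ↦ √(∫ s in a..b, ‖g s ω‖ ^ 2)) 2 P := by
    refine eLpNorm_le_mul_eLpNorm_of_ae_le_mul ?_ 2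
    filter_upwards [hc] with ω hω
    rw [Real.norm_of_nonneg (Real.sqrt_nonneg _)]
    exact norm_intervalIntegral_le_sqrt_mul_sqrt hω hab
  refine h1.trans ((mul_le_mul_right (eLpNorm_sqrt_intervalIntegral_sq_le hg hc hab hK hb) _).trans
    (le_of_eq ?_))
  rw [← ENNReal.ofReal_mul (Real.sqrt_nonneg _), ← mul_assoc,
    Real.mul_self_sqrt (sub_nonneg.2 hab)]

end ProcessIntegrals

/-! ### Cocoercive, strongly monotone vector fields. -/

section MonotoneDrift

variable {H : Type*} [NormedAddCommGroup H] [InnerProductSpace ℝ H]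

/-- `A` is `1 / L`-cocoercive and `μ`-strongly monotone. -/
structure IsMonotoneDrift (A : H → H) (L μ : ℝ) : Prop where
  cocoercive : ∀ x y, ‖A x - A y‖ ^ 2 ≤ L * inner ℝ (x - y) (A x - A y)
  monotone : ∀ x y, μ * ‖x - y‖ ^ 2 ≤ inner ℝ (x - y) (A x - A y)

namespace IsMonotoneDrift

variable {A : H → H} {L μ : ℝ}

lemma norm_sub_le (hA : IsMonotoneDrift A L μ) (hL : 0 ≤ L) (x y : H) :
    ‖A x - A y‖ ≤ L * ‖x - y‖ := by
  rcases (norm_nonneg (A x - A y)).eq_or_lt with h | h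
  · rw [← h]; positivity
  · have h1 := hA.cocoercive x y
    have h2 := mul_le_mul_of_nonneg_left (real_inner_le_norm (x - y) (A x - A y)) hL
    refine le_of_mul_le_mul_right ?_ h
    nlinarith

lemma continuous (hA : IsMonotoneDrift A L μ) (hL : 0 ≤ L) : Continuous A :=
  (LipschitzWith.of_dist_le_mul (K := L.toNNReal) fun x y ↦ by
    simpa [dist_eq_norm, hL] using hA.norm_sub_le hL x y).continuous

/-- An explicit Euler step contracts distances. -/
lemma norm_euler_step_le (hA : IsMonotoneDrift A L μ) (hμ : 0 ≤ μ) {γ : ℝ} (hγ : 0 ≤ γ)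
    (hγL : γ * L ≤ 1) (hγμ : μ * γ ≤ 2) (x y : H) :
    ‖(x - y) - γ • (A x - A y)‖ ≤ (1 - μ * γ / 2) * ‖x - y‖ := by
  have h0 : 0 ≤ 1 - μ * γ / 2 := by linarith
  refine le_of_sq_le_sq ?_ (by positivity)
  rw [norm_sub_sq_real, real_inner_smul_right, norm_smul, mul_pow, mul_pow,
    Real.norm_of_nonneg hγ]
  set i := inner ℝ (x - y) (A x - A y)
  have h1 := hA.cocoercive x y
  have h2 := hA.monotone x y
  have hi : 0 ≤ i := le_trans (by positivity) h2
  -- Cocoercivity lets the quadratic term absorb only half of `-2γ i` as soon as `γ L ≤ 1`; a plain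
  -- Lipschitz bound would need `γ` of order `μ / L²`. What remains is `1 - μγ ≤ (1 - μγ/2)²`.
  have h3 : γ ^ 2 * ‖A x - A y‖ ^ 2 ≤ γ * i :=
    calc γ ^ 2 * ‖A x - A y‖ ^ 2 ≤ γ ^ 2 * (L * i) := by gcongr
      _ = γ * L * (γ * i) := by ring
      _ ≤ 1 * (γ * i) := by gcongr
      _ = γ * i := one_mul _
  nlinarith [mul_le_mul_of_nonneg_left h2 hγ, mul_nonneg (sq_nonneg (μ * γ)) (sq_nonneg ‖x - y‖)]

/-- Exponential stability of the flow of `-A` under a continuous perturbation `w` of its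
argument. -/
lemma sq_norm_sub_le_of_hasDerivAt (hA : IsMonotoneDrift A L μ) (hL : 0 ≤ L) (hμ : 0 < μ)
    {z : H} (hz : A z = 0) {V w : ℝ → H} (hw : Continuous w)
    (hV : ∀ s, HasDerivAt V (-A (V s + w s)) s) {a b : ℝ} (hab : a ≤ b) :
    ‖V b - z‖ ^ 2 ≤ Real.exp (-(μ * (b - a))) * ‖V a - z‖ ^ 2
      + L ^ 2 / μ * ∫ s in a..b, ‖w s‖ ^ 2 := by
  -- A Lyapunov function, made nonincreasing by subtracting the accumulated effect of `w`.
  have hder : ∀ s, HasDerivAt (fun s ↦ Real.exp (μ * (s - a)) * ‖V s - z‖ ^ 2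
        - L ^ 2 / μ * ∫ u in a..s, Real.exp (μ * (u - a)) * ‖w u‖ ^ 2)
      ((Real.exp (μ * (s - a)) * μ) * ‖V s - z‖ ^ 2
        + Real.exp (μ * (s - a)) * (2 * inner ℝ (V s - z) (-A (V s + w s)))
        - L ^ 2 / μ * (Real.exp (μ * (s - a)) * ‖w s‖ ^ 2)) s := fun s ↦ by
    have h1 : HasDerivAt (fun s ↦ Real.exp (μ * (s - a))) (Real.exp (μ * (s - a)) * μ) s := by
      have h : HasDerivAt (fun s ↦ μ * (s - a)) μ s := by
        simpa using ((hasDerivAt_id s).sub_const a).const_mul μ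
      exact h.exp
    have h2 := ((hV s).sub_const z).norm_sq
    have hcont : Continuous fun u ↦ Real.exp (μ * (u - a)) * ‖w u‖ ^ 2 := by fun_prop
    exact (h1.mul h2).sub ((intervalIntegral.integral_hasDerivAt_right
      (hcont.intervalIntegrable _ _) (hcont.stronglyMeasurableAtFilter _ _)
      hcont.continuousAt).const_mul _)
  have hanti := antitoneOn_of_deriv_nonpos (convex_Icc a b)
    (fun s _ ↦ (hder s).continuousAt.continuousWithinAt)
    (fun s _ ↦ (hder s).differentiableAt.differentiableWithinAt)
    (fun s _ ↦ by
      rw [(hder s).deriv]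
      have h1 := hA.monotone (V s) z
      rw [hz, sub_zero] at h1
      have h2 := abs_le.1 ((abs_real_inner_le_norm (V s - z) (A (V s + w s) - A (V s))).trans
        (mul_le_mul_of_nonneg_left (hA.norm_sub_le hL (V s + w s) (V s)) (norm_nonneg _)))
      rw [add_sub_cancel_left, inner_sub_right] at h2
      -- Young's inequality spends half of the dissipation `2μ` on the perturbation, leaving decay
      -- rate `μ`.
      have h3 : 2 * (‖V s - z‖ * (L * ‖w s‖)) ≤ μ * ‖V s - z‖ ^ 2 + L ^ 2 / μ * ‖w s‖ ^ 2 := by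
        have : 0 ≤ (μ * ‖V s - z‖ - L * ‖w s‖) ^ 2 / μ := by positivity
        have e : (μ * ‖V s - z‖ - L * ‖w s‖) ^ 2 / μ = μ * ‖V s - z‖ ^ 2
            + L ^ 2 / μ * ‖w s‖ ^ 2 - 2 * (‖V s - z‖ * (L * ‖w s‖)) := by field_simp; ring
        linarith
      rw [inner_neg_right]
      have h4 : μ * ‖V s - z‖ ^ 2 + 2 * -inner ℝ (V s - z) (A (V s + w s))
          - L ^ 2 / μ * ‖w s‖ ^ 2 ≤ 0 := by linarith [h2.1]
      nlinarith [mul_nonpos_of_nonneg_of_nonpos (Real.exp_pos (μ * (s - a))).le h4])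
  have h := hanti (Set.left_mem_Icc.2 hab) (Set.right_mem_Icc.2 hab) hab
  simp only [sub_self, mul_zero, Real.exp_zero, one_mul, intervalIntegral.integral_same,
    sub_zero] at h
  have h5 : ∫ u in a..b, Real.exp (μ * (u - a)) * ‖w u‖ ^ 2
      ≤ Real.exp (μ * (b - a)) * ∫ u in a..b, ‖w u‖ ^ 2 := by
    rw [← intervalIntegral.integral_const_mul]
    refine intervalIntegral.integral_mono_on hab (Continuous.intervalIntegrable (by fun_prop) _ _)
      (Continuous.intervalIntegrable (by fun_prop) _ _) fun u hu ↦ ?_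
    have := hu.2
    gcongr
  have h6 : Real.exp (μ * (b - a)) * ‖V b - z‖ ^ 2 ≤ ‖V a - z‖ ^ 2
      + L ^ 2 / μ * (Real.exp (μ * (b - a)) * ∫ u in a..b, ‖w u‖ ^ 2) := by
    have := mul_le_mul_of_nonneg_left h5 (show 0 ≤ L ^ 2 / μ by positivity)
    linarith
  have hE := Real.exp_pos (μ * (b - a))
  rw [Real.exp_neg]
  refine le_of_mul_le_mul_left (h6.trans (le_of_eq ?_)) hE
  field_simp

/-- The unsquared form, suited to the triangle inequality in `L²`. -/
lemma norm_sub_le_of_hasDerivAt (hA : IsMonotoneDrift A L μ) (hL : 0 ≤ L) (hμ : 0 < μ)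
    {z : H} (hz : A z = 0) {V w : ℝ → H} (hw : Continuous w)
    (hV : ∀ s, HasDerivAt V (-A (V s + w s)) s) {a b : ℝ} (hab : a ≤ b) :
    ‖V b - z‖ ≤ Real.exp (-(μ * (b - a) / 2)) * ‖V a - z‖
      + L / √μ * √(∫ s in a..b, ‖w s‖ ^ 2) := by
  have hI : 0 ≤ ∫ s in a..b, ‖w s‖ ^ 2 :=
    intervalIntegral.integral_nonneg hab fun _ _ ↦ sq_nonneg _
  refine le_of_sq_le_sq ?_ (by positivity)
  refine (hA.sq_norm_sub_le_of_hasDerivAt hL hμ hz hw hV hab).trans ?_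
  have e1 : Real.exp (-(μ * (b - a))) = Real.exp (-(μ * (b - a) / 2)) ^ 2 := by
    rw [← Real.exp_nat_mul]; congr 1; push_cast; ring
  have e2 : (L / √μ * √(∫ s in a..b, ‖w s‖ ^ 2)) ^ 2 = L ^ 2 / μ * ∫ s in a..b, ‖w s‖ ^ 2 := by
    rw [mul_pow, div_pow, Real.sq_sqrt hμ.le, Real.sq_sqrt hI]
  rw [e1, add_sq, mul_pow, e2]
  have : 0 ≤ 2 * (Real.exp (-(μ * (b - a) / 2)) * ‖V a - z‖)
      * (L / √μ * √(∫ s in a..b, ‖w s‖ ^ 2)) := by positivity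
  linarith

end IsMonotoneDrift

end MonotoneDrift

/-! ### Moments and Euler error for equations with additive noise. -/

section AdditiveNoise

variable {Ω : Type*} [MeasurableSpace Ω] {P : Measure Ω}
  {H : Type*} [NormedAddCommGroup H] [InnerProductSpace ℝ H]

/-- `Z` solves `dZ = -A(Z) dt + dW` on `[0, ∞)`, where the increments of the noise satisfy
`‖W t - W s‖_{L²} ≤ σ √(t - s)`. -/
structure IsAdditiveNoiseSolution (A : H → H) (W Z : ℝ → Ω → H) (σ : ℝ) (P : Measure Ω) :
    Prop where
  aestronglyMeasurable_noise : ∀ s, AEStronglyMeasurable (W s) P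
  aestronglyMeasurable : ∀ s, AEStronglyMeasurable (Z s) P
  continuous_noise : ∀ᵐ ω ∂P, Continuous fun s ↦ W s ω
  continuous : ∀ᵐ ω ∂P, Continuous fun s ↦ Z s ω
  eLpNorm_noise_sub_le : ∀ s t, 0 ≤ s → s ≤ t →
    eLpNorm (W t - W s) 2 P ≤ ENNReal.ofReal (σ * √(t - s))
  eq : ∀ᵐ ω ∂P, ∀ s t, 0 ≤ s → s ≤ t →
    Z t ω = Z s ω - (∫ u in s..t, A (Z u ω)) + (W t ω - W s ω)

namespace IsAdditiveNoiseSolution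

variable [IsProbabilityMeasure P] {A : H → H} {L μ σ : ℝ} {W Z : ℝ → Ω → H}

/-- The drift, of size at most `L * S` in `L²`, contributes linearly in `b - a`; the noise
contributes the square root. -/
lemma eLpNorm_increment_le (hZ : IsAdditiveNoiseSolution A W Z σ P)
    (hA : IsMonotoneDrift A L μ) (hL : 0 ≤ L) (hσ : 0 ≤ σ) {z : H} (hz : A z = 0)
    {S : ℝ} (hS : 0 ≤ S) (h : ∀ t, 0 ≤ t → eLpNorm (fun ω ↦ Z t ω - z) 2 P ≤ ENNReal.ofReal S)
    {a b : ℝ} (ha : 0 ≤ a) (hab : a ≤ b) :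
    eLpNorm (fun ω ↦ Z b ω - Z a ω) 2 P
      ≤ ENNReal.ofReal ((b - a) * (L * S) + σ * √(b - a)) := by
  have hAc := hA.continuous hL
  have hm : ∀ s, AEStronglyMeasurable (fun ω ↦ A (Z s ω)) P := fun s ↦
    hAc.comp_aestronglyMeasurable (hZ.aestronglyMeasurable s)
  have hc : ∀ᵐ ω ∂P, Continuous fun s ↦ A (Z s ω) := by
    filter_upwards [hZ.continuous] with ω h using hAc.comp h
  have h1 : eLpNorm (fun ω ↦ ∫ s in a..b, A (Z s ω)) 2 P ≤ ENNReal.ofReal ((b - a) * (L * S)) := by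
    refine eLpNorm_intervalIntegral_le hm hc hab (by positivity) fun s hs ↦ ?_
    rw [ENNReal.ofReal_mul hL]
    refine (eLpNorm_le_mul_eLpNorm_of_ae_le_mul (ae_of_all _ fun ω ↦ ?_) 2).trans
      (mul_le_mul_right (h s (ha.trans hs.1)) _)
    simpa [hz] using hA.norm_sub_le hL (Z s ω) z
  have heq : (fun ω ↦ Z b ω - Z a ω) =ᵐ[P]
      (W b - W a) - fun ω ↦ ∫ s in a..b, A (Z s ω) := by
    filter_upwards [hZ.eq] with ω h
    rw [h a b ha hab]
    simp only [Pi.sub_apply]; abel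
  rw [eLpNorm_congr_ae heq]
  have hba : 0 ≤ b - a := sub_nonneg.2 hab
  refine (eLpNorm_sub_le ((hZ.aestronglyMeasurable_noise b).sub (hZ.aestronglyMeasurable_noise a))
    (aestronglyMeasurable_intervalIntegral hm hc hab) (by norm_num)).trans ?_
  rw [add_comm, ENNReal.ofReal_add (by positivity) (by positivity)]
  exact add_le_add h1 (hZ.eLpNorm_noise_sub_le a b ha hab)

variable [CompleteSpace H]

/-- Removing the noise accumulated since `a` leaves an ODE with perturbed argument, to which the
exponential stability estimate applies path by path. Windows of length at most one keep the noise
terms bounded by multiples of `σ`. -/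
lemma eLpNorm_sub_le_of_le_add_one (hZ : IsAdditiveNoiseSolution A W Z σ P)
    (hA : IsMonotoneDrift A L μ) (hL : 0 ≤ L) (hμ : 0 < μ) (hσ : 0 ≤ σ) {z : H} (hz : A z = 0)
    {a b m : ℝ} (ha : 0 ≤ a) (hab : a ≤ b) (hb : b ≤ a + 1) (hm : 0 ≤ m)
    (h : eLpNorm (fun ω ↦ Z a ω - z) 2 P ≤ ENNReal.ofReal m) :
    eLpNorm (fun ω ↦ Z b ω - z) 2 P
      ≤ ENNReal.ofReal (Real.exp (-(μ * (b - a) / 2)) * m + (L / √μ + 1) * σ) := by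
  set q := Real.exp (-(μ * (b - a) / 2)) with hq
  have hq0 : 0 ≤ q := (Real.exp_pos _).le
  have hAc := hA.continuous hL
  have hwm : ∀ s, AEStronglyMeasurable (fun ω ↦ W s ω - W a ω) P := fun s ↦
    (hZ.aestronglyMeasurable_noise s).sub (hZ.aestronglyMeasurable_noise a)
  have hwc : ∀ᵐ ω ∂P, Continuous fun s ↦ W s ω - W a ω := by
    filter_upwards [hZ.continuous_noise] with ω h using h.sub continuous_const
  have hsqrt : √(b - a) ≤ 1 := Real.sqrt_le_one.2 (by linarith)
  have hF : eLpNorm (fun ω ↦ √(∫ s in a..b, ‖W s ω - W a ω‖ ^ 2)) 2 P ≤ ENNReal.ofReal σ := by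
    refine (eLpNorm_sqrt_intervalIntegral_sq_le hwm hwc hab hσ fun s hs ↦
      (hZ.eLpNorm_noise_sub_le a s ha hs.1).trans (ENNReal.ofReal_le_ofReal ?_)).trans
      (ENNReal.ofReal_le_ofReal (mul_le_of_le_one_left hσ hsqrt))
    exact mul_le_of_le_one_right hσ (Real.sqrt_le_one.2 (by linarith [hs.2]))
  have hFm := aestronglyMeasurable_sqrt_intervalIntegral_sq hwm hwc hab
  have hpath : ∀ᵐ ω ∂P, ‖Z b ω - z‖ ≤ q * ‖Z a ω - z‖
      + L / √μ * √(∫ s in a..b, ‖W s ω - W a ω‖ ^ 2) + ‖W b ω - W a ω‖ := by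
    filter_upwards [hZ.continuous, hZ.eq] with ω hc heq
    have hcA : Continuous fun s ↦ A (Z s ω) := hAc.comp hc
    set V : ℝ → H := fun s ↦ Z a ω - ∫ u in a..s, A (Z u ω) with hV
    have hVd : ∀ s, HasDerivAt V (-A (Z s ω)) s := fun s ↦
      (intervalIntegral.integral_hasDerivAt_right (hcA.intervalIntegrable _ _)
        (hcA.stronglyMeasurableAtFilter _ _) hcA.continuousAt).const_sub _
    have hVc : Continuous V := continuous_iff_continuousAt.2 fun s ↦ (hVd s).continuousAt
    have hw : ∀ s, a ≤ s → Z s ω - V s = W s ω - W a ω := fun s hs ↦ by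
      simp only [hV, heq a s ha hs]; abel
    -- The perturbation is taken as `Z - V`, so that the ODE holds at every real time; it equals the
    -- noise increment only from time `a` on.
    have h1 := hA.norm_sub_le_of_hasDerivAt hL hμ hz (V := V) (w := fun s ↦ Z s ω - V s)
      (hc.sub hVc) (fun s ↦ by simpa using hVd s) hab
    have h2 : ∫ s in a..b, ‖Z s ω - V s‖ ^ 2 = ∫ s in a..b, ‖W s ω - W a ω‖ ^ 2 := by
      refine intervalIntegral.integral_congr fun s hs ↦ ?_
      rw [Set.uIcc_of_le hab] at hs
      simp only [hw s hs.1]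
    have h3 : V a = Z a ω := by simp [hV]
    rw [h2, h3] at h1
    have h4 : Z b ω - z = (V b - z) + (W b ω - W a ω) := by rw [← hw b hab]; abel
    rw [h4]
    exact (norm_add_le _ _).trans (by linarith)
  have e1 := eLpNorm_mono_ae_real hpath (p := 2)
  refine e1.trans ?_
  have hZm : AEStronglyMeasurable (fun ω ↦ ‖Z a ω - z‖) P :=
    ((hZ.aestronglyMeasurable a).sub aestronglyMeasurable_const).norm
  have s1 : eLpNorm (fun ω ↦ q * ‖Z a ω - z‖) 2 P ≤ ENNReal.ofReal (q * m) := by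
    rw [ENNReal.ofReal_mul hq0]
    refine (eLpNorm_le_mul_eLpNorm_of_ae_le_mul (ae_of_all _ fun ω ↦ ?_) 2).trans
      (mul_le_mul_right h _)
    rw [norm_mul, norm_norm, Real.norm_of_nonneg hq0]
  have s2 : eLpNorm (fun ω ↦ L / √μ * √(∫ s in a..b, ‖W s ω - W a ω‖ ^ 2)) 2 P
      ≤ ENNReal.ofReal (L / √μ * σ) := by
    rw [ENNReal.ofReal_mul (by positivity)]
    refine (eLpNorm_le_mul_eLpNorm_of_ae_le_mul (ae_of_all _ fun ω ↦ ?_) 2).trans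
      (mul_le_mul_right hF _)
    rw [norm_mul, Real.norm_of_nonneg (show 0 ≤ L / √μ by positivity)]
  have s3 : eLpNorm (fun ω ↦ ‖W b ω - W a ω‖) 2 P ≤ ENNReal.ofReal σ := by
    rw [eLpNorm_norm]
    exact (hZ.eLpNorm_noise_sub_le a b ha hab).trans
      (ENNReal.ofReal_le_ofReal (mul_le_of_le_one_right hσ hsqrt))
  calc _ ≤ eLpNorm (fun ω ↦ q * ‖Z a ω - z‖
          + L / √μ * √(∫ s in a..b, ‖W s ω - W a ω‖ ^ 2)) 2 P
          + eLpNorm (fun ω ↦ ‖W b ω - W a ω‖) 2 P :=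
        eLpNorm_add_le ((hZm.const_mul q).add (hFm.const_mul _)) (hwm b).norm (by norm_num)
    _ ≤ eLpNorm (fun ω ↦ q * ‖Z a ω - z‖) 2 P
          + eLpNorm (fun ω ↦ L / √μ * √(∫ s in a..b, ‖W s ω - W a ω‖ ^ 2)) 2 P
          + eLpNorm (fun ω ↦ ‖W b ω - W a ω‖) 2 P := by
        gcongr
        exact eLpNorm_add_le (hZm.const_mul q) (hFm.const_mul _) (by norm_num)
    _ ≤ ENNReal.ofReal (q * m) + ENNReal.ofReal (L / √μ * σ) + ENNReal.ofReal σ := by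
        gcongr
    _ = _ := by
        rw [← ENNReal.ofReal_add (by positivity) (by positivity),
          ← ENNReal.ofReal_add (by positivity) (by positivity)]
        congr 1; ring

/-- Second moments are bounded uniformly in time. -/
lemma eLpNorm_sub_const_le (hZ : IsAdditiveNoiseSolution A W Z σ P)
    (hA : IsMonotoneDrift A L μ) (hL : 0 ≤ L) (hμ : 0 < μ) (hσ : 0 ≤ σ) {z : H} (hz : A z = 0)
    {r : ℝ} (hr : 0 ≤ r) (h : eLpNorm (fun ω ↦ Z 0 ω - z) 2 P ≤ ENNReal.ofReal r)
    {t : ℝ} (ht : 0 ≤ t) :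
    eLpNorm (fun ω ↦ Z t ω - z) 2 P
      ≤ ENNReal.ofReal (r + (L / √μ + 1) * ((1 - Real.exp (-(μ / 2)))⁻¹ + 1) * σ) := by
  set c := (L / √μ + 1) * σ with hc
  set q := Real.exp (-(μ / 2)) with hq
  have hc0 : 0 ≤ c := by positivity
  have hq0 : 0 < q := Real.exp_pos _
  have hq1 : q < 1 := by rw [hq, Real.exp_lt_one_iff]; linarith
  have hq2 : 0 < 1 - q := by linarith
  have hnat : ∀ n : ℕ, eLpNorm (fun ω ↦ Z n ω - z) 2 P
      ≤ ENNReal.ofReal (r + (1 - q)⁻¹ * c) := fun n ↦ by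
    induction n with
    | zero =>
      rw [Nat.cast_zero]
      exact h.trans (ENNReal.ofReal_le_ofReal (le_add_of_nonneg_right (by positivity)))
    | succ n ih =>
      have := hZ.eLpNorm_sub_le_of_le_add_one hA hL hμ hσ hz (Nat.cast_nonneg n)
        (b := ((n + 1 : ℕ) : ℝ)) (by push_cast; linarith) (by push_cast; linarith)
        (by positivity) ih
      refine this.trans (ENNReal.ofReal_le_ofReal ?_)
      rw [show ((n + 1 : ℕ) : ℝ) - n = 1 by push_cast; ring, mul_one, ← hq, ← hc]
      -- `(1 - q)⁻¹ * c` is the fixed point of the one-window recursion `m ↦ q * m + c`.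
      have e : q * ((1 - q)⁻¹ * c) + c = (1 - q)⁻¹ * c := by field_simp; ring
      nlinarith
  have hfl := Nat.floor_le ht
  -- A last partial window from `⌊t⌋₊` to `t` costs one more `c`, whence the `+ 1` in the bound.
  have := hZ.eLpNorm_sub_le_of_le_add_one hA hL hμ hσ hz (Nat.cast_nonneg ⌊t⌋₊) hfl
    (Nat.lt_floor_add_one t).le (by positivity) (hnat _)
  refine this.trans (ENNReal.ofReal_le_ofReal ?_)
  rw [← hc]
  have h1 : Real.exp (-(μ * (t - ⌊t⌋₊) / 2)) ≤ 1 := by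
    rw [Real.exp_le_one_iff]
    have := mul_nonneg hμ.le (sub_nonneg.2 hfl)
    linarith
  have h2 : Real.exp (-(μ * (t - ⌊t⌋₊) / 2)) * (r + (1 - q)⁻¹ * c) ≤ r + (1 - q)⁻¹ * c :=
    mul_le_of_le_one_left (by positivity) h1
  calc _ ≤ r + (1 - q)⁻¹ * c + c := by linarith
    _ = _ := by rw [hc]; ring

/-- The strong error of the Euler–Maruyama scheme is of order `√γ`, uniformly in time. -/
theorem eLpNorm_euler_sub_le (hZ : IsAdditiveNoiseSolution A W Z σ P)
    (hA : IsMonotoneDrift A L μ) (hL : 0 ≤ L) (hμ : 0 < μ) (hσ : 0 ≤ σ) {z : H} (hz : A z = 0)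
    {S : ℝ} (hS : 0 ≤ S) (h : ∀ t, 0 ≤ t → eLpNorm (fun ω ↦ Z t ω - z) 2 P ≤ ENNReal.ofReal S)
    {γ : ℝ} (hγ : 0 < γ) (hγL : γ * L ≤ 1) (hγμ : μ * γ ≤ 2)
    {Y : ℕ → Ω → H} (hY0 : Y 0 =ᵐ[P] Z 0)
    (hY : ∀ n, Y (n + 1) =ᵐ[P] fun ω ↦
      Y n ω - γ • A (Y n ω) + (W ((n + 1) * γ) ω - W (n * γ) ω)) (n : ℕ) :
    AEStronglyMeasurable (Y n) P ∧ eLpNorm (fun ω ↦ Y n ω - Z (n * γ) ω) 2 P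
      ≤ ENNReal.ofReal (2 * (L * (√γ * (L * S) + σ)) / μ * √γ) := by
  have hAc := hA.continuous hL
  set K := L * (√γ * (L * S) + σ) with hK
  have hK0 : 0 ≤ K := by positivity
  induction n with
  | zero =>
    refine ⟨(hZ.aestronglyMeasurable 0).congr hY0.symm, ?_⟩
    have : (fun ω ↦ Y 0 ω - Z ((0 : ℕ) * γ) ω) =ᵐ[P] 0 := by
      filter_upwards [hY0] with ω h0
      simp [h0]
    rw [eLpNorm_congr_ae this]
    simp
  | succ n ih =>
    obtain ⟨hYm, ihe⟩ := ih
    have hcast : ((n + 1 : ℕ) : ℝ) * γ = (n + 1) * γ := by push_cast; ring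
    have hlen : ((n : ℝ) + 1) * γ - n * γ = γ := by ring
    have hab : (n : ℝ) * γ ≤ (n + 1) * γ := by linarith
    have ha : 0 ≤ (n : ℝ) * γ := by positivity
    refine ⟨AEStronglyMeasurable.congr ((hYm.sub ((hAc.comp_aestronglyMeasurable hYm).const_smul
      γ)).add ((hZ.aestronglyMeasurable_noise _).sub (hZ.aestronglyMeasurable_noise _)))
      (hY n).symm, ?_⟩
    rw [hcast]
    set Zn := Z (n * γ) with hZn
    have hZm : AEStronglyMeasurable Zn P := hZ.aestronglyMeasurable _
    have hm : ∀ s, AEStronglyMeasurable (fun ω ↦ A (Z s ω) - A (Zn ω)) P := fun s ↦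
      (hAc.comp_aestronglyMeasurable (hZ.aestronglyMeasurable s)).sub
        (hAc.comp_aestronglyMeasurable hZm)
    have hc : ∀ᵐ ω ∂P, Continuous fun s ↦ A (Z s ω) - A (Zn ω) := by
      filter_upwards [hZ.continuous] with ω h using (hAc.comp h).sub continuous_const
    -- The common noise increment cancels, leaving the difference of two Euler steps and the local
    -- error of freezing the drift at the grid time.
    have heq : (fun ω ↦ Y (n + 1) ω - Z ((n + 1) * γ) ω) =ᵐ[P]
        (fun ω ↦ (Y n ω - Zn ω) - γ • (A (Y n ω) - A (Zn ω)))
          + fun ω ↦ ∫ s in (n * γ)..((n + 1) * γ), (A (Z s ω) - A (Zn ω)) := by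
      filter_upwards [hY n, hZ.eq, hZ.continuous] with ω h1 h2 h3
      have hcA : Continuous fun s ↦ A (Z s ω) := hAc.comp h3
      rw [h1, h2 _ _ ha hab]
      simp only [Pi.add_apply]
      rw [intervalIntegral.integral_sub (hcA.intervalIntegrable _ _) (by simp),
        intervalIntegral.integral_const, hlen, smul_sub]
      abel
    rw [eLpNorm_congr_ae heq]
    have h1μ : 0 ≤ 1 - μ * γ / 2 := by linarith
    have s1 : eLpNorm (fun ω ↦ (Y n ω - Zn ω) - γ • (A (Y n ω) - A (Zn ω))) 2 P
        ≤ ENNReal.ofReal ((1 - μ * γ / 2) * (2 * K / μ * √γ)) := by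
      rw [ENNReal.ofReal_mul h1μ]
      exact (eLpNorm_le_mul_eLpNorm_of_ae_le_mul (ae_of_all _ fun ω ↦
        hA.norm_euler_step_le hμ.le hγ.le hγL hγμ (Y n ω) (Zn ω)) 2).trans
        (mul_le_mul_right ihe _)
    have s2 : eLpNorm (fun ω ↦ ∫ s in (n * γ)..((n + 1) * γ), (A (Z s ω) - A (Zn ω))) 2 P
        ≤ ENNReal.ofReal (γ * (L * (γ * (L * S) + σ * √γ))) := by
      have := eLpNorm_intervalIntegral_le hm hc hab
        (K := L * (γ * (L * S) + σ * √γ)) (by positivity) fun s hs ↦ ?_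
      · rwa [hlen] at this
      have hsγ : s - n * γ ≤ γ := by linarith [hs.2]
      rw [ENNReal.ofReal_mul hL]
      refine (eLpNorm_le_mul_eLpNorm_of_ae_le_mul (ae_of_all _ fun ω ↦
        hA.norm_sub_le hL (Z s ω) (Zn ω)) 2).trans (mul_le_mul_right ?_ _)
      refine (hZ.eLpNorm_increment_le hA hL hσ hz hS h ha hs.1).trans
        (ENNReal.ofReal_le_ofReal ?_)
      gcongr
    refine (eLpNorm_add_le ((hYm.sub hZm).sub (((hAc.comp_aestronglyMeasurable hYm).sub
      (hAc.comp_aestronglyMeasurable hZm)).const_smul γ))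
      (aestronglyMeasurable_intervalIntegral hm hc hab) (by norm_num)).trans ?_
    refine (add_le_add s1 s2).trans (le_of_eq ?_)
    rw [← ENNReal.ofReal_add (by positivity) (by positivity)]
    congr 1
    have hs : √γ * √γ = γ := Real.mul_self_sqrt hγ.le
    -- The local error is `γ √γ K`, and `2 K √γ / μ` is exactly the fixed point of `e ↦ (1 - μγ/2) e
    -- + γ √γ K`, so the induction closes with equality.
    have e1 : γ * (L * (γ * (L * S) + σ * √γ)) = γ * √γ * K := by
      rw [hK]; linear_combination (-γ * L * L * S) * hs
    rw [e1]
    field_simp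
    ring

end IsAdditiveNoiseSolution

end AdditiveNoise

namespace IPLA

variable {dθ dx N : ℕ}

/-! ### The rescaled state space and its drift. -/

section Cloud

/-- The state space of the particle system. A state `(θ, X¹, …, Xᴺ)` is represented by
`(θ, N^{-1/2} X¹, …, N^{-1/2} Xᴺ)`, see `cloud`. -/
abbrev CloudSpace (dθ dx N : ℕ) : Type :=
  WithLp 2 (Euc dθ × PiLp 2 (fun _ : Fin N ↦ Euc dx))

/-- The representation of `(θ, X¹, …, Xᴺ)` in `CloudSpace`; its squared norm is
`‖θ‖² + N⁻¹ ∑ ‖Xⁱ‖²`. -/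
noncomputable def cloud (θ : Euc dθ) (X : Fin N → Euc dx) : CloudSpace dθ dx N :=
  WithLp.toLp 2 (θ, WithLp.toLp 2 fun i ↦ (√(N : ℝ))⁻¹ • X i)

/-- The pair `(θ, Xʲ)` of a state. -/
noncomputable def lift (z : CloudSpace dθ dx N) (j : Fin N) : Joint dθ dx :=
  WithLp.toLp 2 (z.fst, √(N : ℝ) • z.snd j)

/-- Minus the drift of the particle system. -/
noncomputable def cloudDrift (U : Joint dθ dx → ℝ) (z : CloudSpace dθ dx N) :
    CloudSpace dθ dx N :=
  cloud ((1 / (N : ℝ)) • ∑ j, (gradient U (lift z j)).fst) fun j ↦ (gradient U (lift z j)).snd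

@[simp] lemma cloud_fst (θ : Euc dθ) (X : Fin N → Euc dx) : (cloud θ X).fst = θ := rfl

@[simp] lemma cloud_snd (θ : Euc dθ) (X : Fin N → Euc dx) (i : Fin N) :
    (cloud θ X).snd i = (√(N : ℝ))⁻¹ • X i := rfl

lemma CloudSpace.ext {z z' : CloudSpace dθ dx N} (h1 : z.fst = z'.fst)
    (h2 : ∀ i, z.snd i = z'.snd i) : z = z' :=
  WithLp.ofLp_injective 2 (Prod.ext h1 (PiLp.ext h2))

lemma cloud_sub (θ θ' : Euc dθ) (X X' : Fin N → Euc dx) :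
    cloud θ X - cloud θ' X' = cloud (θ - θ') (fun i ↦ X i - X' i) :=
  CloudSpace.ext rfl fun _ ↦ (smul_sub _ _ _).symm

lemma continuous_cloud : Continuous fun p : Euc dθ × (Fin N → Euc dx) ↦ cloud p.1 p.2 := by
  unfold cloud
  fun_prop

lemma sq_norm_cloud (θ : Euc dθ) (X : Fin N → Euc dx) :
    ‖cloud θ X‖ ^ 2 = ‖θ‖ ^ 2 + 1 / (N : ℝ) * ∑ i, ‖X i‖ ^ 2 := by
  rw [WithLp.prod_norm_sq_eq_of_L2, PiLp.norm_sq_eq_of_L2 _ (cloud θ X).snd, cloud_fst,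
    Finset.mul_sum]
  congr 1
  refine Finset.sum_congr rfl fun i _ ↦ ?_
  rw [cloud_snd, norm_smul, mul_pow, norm_inv, inv_pow, Real.norm_of_nonneg (Real.sqrt_nonneg _),
    Real.sq_sqrt (Nat.cast_nonneg _), one_div]

lemma lift_cloud (hN : 1 ≤ N) (θ : Euc dθ) (X : Fin N → Euc dx) (j : Fin N) :
    lift (cloud θ X) j = WithLp.toLp 2 (θ, X j) := by
  have : √(N : ℝ) ≠ 0 := (Real.sqrt_pos.2 (by exact_mod_cast hN)).ne'
  simp [lift, smul_smul, this]

lemma cloudDrift_cloud (hN : 1 ≤ N) (U : Joint dθ dx → ℝ) (θ : Euc dθ) (X : Fin N → Euc dx) :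
    cloudDrift U (cloud θ X)
      = cloud ((1 / (N : ℝ)) • ∑ j, gradTheta U θ (X j)) fun j ↦ gradX U θ (X j) := by
  simp only [cloudDrift, lift_cloud hN, gradTheta, gradX]

lemma cloudDrift_sub (U : Joint dθ dx → ℝ) (z z' : CloudSpace dθ dx N) :
    cloudDrift U z - cloudDrift U z' =
      cloud ((1 / (N : ℝ)) • ∑ j, (gradient U (lift z j) - gradient U (lift z' j)).fst)
        fun j ↦ (gradient U (lift z j) - gradient U (lift z' j)).snd := by
  simp only [cloudDrift, cloud_sub, ← smul_sub, ← Finset.sum_sub_distrib, WithLp.sub_fst,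
    WithLp.sub_snd]

lemma lift_sub (z z' : CloudSpace dθ dx N) (j : Fin N) :
    lift (z - z') j = lift z j - lift z' j := by
  refine WithLp.ofLp_injective 2 (Prod.ext rfl ?_)
  exact smul_sub _ (z.snd j) (z'.snd j)

/-- The factor `N^{-1/2}` in `cloud` equals `1 / N` times the `√N` in `lift`, so the `x`-blocks
carry the same weight `1 / N` as the averaged `θ`-block. -/
lemma inner_cloud (hN : 1 ≤ N) (z : CloudSpace dθ dx N) (g : Fin N → Joint dθ dx) :
    inner ℝ z (cloud ((1 / (N : ℝ)) • ∑ j, (g j).fst) fun j ↦ (g j).snd)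
      = 1 / (N : ℝ) * ∑ j, inner ℝ (lift z j) (g j) := by
  have hN' : (0 : ℝ) < N := by exact_mod_cast hN
  have hss : (√(N : ℝ))⁻¹ = 1 / (N : ℝ) * √(N : ℝ) := by
    field_simp
    rw [Real.sq_sqrt hN'.le]
  have h1 : ∀ j, inner ℝ (lift z j) (g j)
      = inner ℝ z.fst (g j).fst + √(N : ℝ) * inner ℝ (z.snd j) (g j).snd := fun j ↦ by
    rw [WithLp.prod_inner_apply]
    exact congrArg _ (real_inner_smul_left _ _ _)
  rw [WithLp.prod_inner_apply]
  simp_rw [h1]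
  rw [Finset.sum_add_distrib, mul_add, ← inner_sum, ← Finset.mul_sum, ← mul_assoc, ← hss,
    Finset.mul_sum]
  refine congrArg₂ (· + ·) (real_inner_smul_right _ _ _) ((PiLp.inner_apply _ _).trans ?_)
  exact Finset.sum_congr rfl fun i _ ↦ real_inner_smul_right _ _ _

lemma sq_norm_eq_average (hN : 1 ≤ N) (z : CloudSpace dθ dx N) :
    ‖z‖ ^ 2 = 1 / (N : ℝ) * ∑ j, ‖lift z j‖ ^ 2 := by
  have hN' : (0 : ℝ) < N := by exact_mod_cast hN
  have h1 : ∀ j, ‖lift z j‖ ^ 2 = ‖z.fst‖ ^ 2 + N * ‖z.snd j‖ ^ 2 := fun j ↦ by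
    rw [WithLp.prod_norm_sq_eq_of_L2]
    simp only [lift, WithLp.toLp_fst, WithLp.toLp_snd]
    rw [norm_smul, mul_pow, Real.norm_of_nonneg (Real.sqrt_nonneg _), Real.sq_sqrt hN'.le]
  simp_rw [h1]
  rw [WithLp.prod_norm_sq_eq_of_L2, PiLp.norm_sq_eq_of_L2 _ z.snd, Finset.sum_add_distrib,
    ← Finset.mul_sum, Finset.sum_const, Finset.card_univ, Fintype.card_fin, nsmul_eq_mul]
  field_simp

/-- Jensen's inequality on the `θ`-block; the `x`-blocks give equality. -/
lemma sq_norm_cloud_average_le (hN : 1 ≤ N) (g : Fin N → Joint dθ dx) :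
    ‖cloud ((1 / (N : ℝ)) • ∑ j, (g j).fst) fun j ↦ (g j).snd‖ ^ 2
      ≤ 1 / (N : ℝ) * ∑ j, ‖g j‖ ^ 2 := by
  have hN' : (0 : ℝ) < N := by exact_mod_cast hN
  have h1 : ‖∑ j, (g j).fst‖ ^ 2 ≤ N * ∑ j, ‖(g j).fst‖ ^ 2 := by
    calc ‖∑ j, (g j).fst‖ ^ 2 ≤ (∑ j, ‖(g j).fst‖) ^ 2 := by
          gcongr; exact norm_sum_le _ _
      _ ≤ _ := by simpa using sq_sum_le_card_mul_sum_sq (s := Finset.univ)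
                    (f := fun j ↦ ‖(g j).fst‖)
  rw [sq_norm_cloud, norm_smul, mul_pow, Real.norm_of_nonneg (by positivity)]
  simp only [WithLp.prod_norm_sq_eq_of_L2, Finset.sum_add_distrib, mul_add]
  refine add_le_add ?_ le_rfl
  calc (1 / (N : ℝ)) ^ 2 * ‖∑ j, (g j).fst‖ ^ 2
      ≤ (1 / (N : ℝ)) ^ 2 * (N * ∑ j, ‖(g j).fst‖ ^ 2) := by gcongr
    _ = _ := by field_simp

lemma isMonotoneDrift_cloudDrift (hN : 1 ≤ N) {U : Joint dθ dx → ℝ} {L μ : ℝ} (hL : 0 < L)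
    (hμ : 0 < μ) (hU : Differentiable ℝ U) (hLip : OverallLipschitz U L)
    (hmono : StronglyMonotone U μ) :
    IsMonotoneDrift (cloudDrift (N := N) U) L μ where
  cocoercive z z' := by
    rw [cloudDrift_sub, inner_cloud hN]
    refine (sq_norm_cloud_average_le hN _).trans ?_
    rw [mul_left_comm, Finset.mul_sum _ _ L]
    simp only [lift_sub]
    gcongr with j
    exact gradient_cocoercive hL hU hLip
      (fun v w ↦ le_trans (by positivity) (hmono v w)) _ _
  monotone z z' := by
    rw [cloudDrift_sub, inner_cloud hN, sq_norm_eq_average hN, mul_left_comm, Finset.mul_sum _ _ μ]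
    simp only [lift_sub]
    gcongr with j
    exact hmono _ _

lemma cloudDrift_eq_zero (hN : 1 ≤ N) {U : Joint dθ dx → ℝ} {v : Joint dθ dx}
    (hv : ∀ w, U v ≤ U w) : cloudDrift (N := N) U (cloud v.fst fun _ ↦ v.snd) = 0 := by
  have h0 : gradient U v = 0 := by
    have : IsLocalMin U v := Filter.Eventually.of_forall hv
    simp [gradient, this.fderiv_eq_zero]
  have h1 : ∀ j, lift (cloud (N := N) v.fst fun _ ↦ v.snd) j = v := fun j ↦ lift_cloud hN _ _ j
  refine CloudSpace.ext ?_ fun i ↦ ?_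
  · simp [cloudDrift, h1, h0]
  · simp [cloudDrift, h1, h0]

end Cloud

/-! ### Second moments of Brownian increments. -/

section Noise

variable {Ω : Type*} [MeasurableSpace Ω] {P : Measure Ω}

lemma lintegral_sq_brownian_increment {B : ℝ≥0 → Ω → ℝ} (hB : IsPreBrownianReal B P) (s t : ℝ≥0) :
    ∫⁻ ω, ‖B t ω - B s ω‖ₑ ^ 2 ∂P = nndist (t : ℝ) s := by
  have h := (hB.hasLaw_sub t s).lintegral_comp (f := fun x ↦ ‖x‖ₑ ^ 2) (by fun_prop)
  have h2 := ofReal_variance (memLp_id_gaussianReal (μ := 0) (v := nndist (t : ℝ) s) 2)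
  rw [variance_id_gaussianReal, evariance] at h2
  simp only [id_eq, integral_id_gaussianReal, sub_zero, ENNReal.ofReal_coe_nnreal] at h2
  exact h.trans h2.symm

variable {d : ℕ} {B : ℝ≥0 → Ω → Euc d}

lemma IsBrownian.aemeasurable (hB : IsBrownian B P) (t : ℝ≥0) : AEMeasurable (B t) P := by
  have : AEMeasurable (fun ω k ↦ B t ω k) P :=
    aemeasurable_pi_lambda _ fun k ↦ (hB.coord k).aemeasurable t
  exact (WithLp.measurable_toLp 2 _).comp_aemeasurable this

lemma IsBrownian.aestronglyMeasurable (hB : IsBrownian B P) (t : ℝ≥0) :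
    AEStronglyMeasurable (B t) P :=
  (hB.aemeasurable t).aestronglyMeasurable

lemma IsBrownian.ae_continuous (hB : IsBrownian B P) : ∀ᵐ ω ∂P, Continuous fun t ↦ B t ω := by
  filter_upwards [ae_all_iff.2 fun k ↦ (hB.coord k).cont] with ω h
  exact (PiLp.continuous_toLp 2 _).comp (continuous_pi h)

lemma IsBrownian.ae_eq_zero (hB : IsBrownian B P) : ∀ᵐ ω ∂P, B 0 ω = 0 := by
  filter_upwards [ae_all_iff.2 fun k ↦ (hB.coord k).eval_zero_ae_eq_zero] with ω h
  ext k
  simpa using h k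

lemma IsBrownian.lintegral_sq_increment (hB : IsBrownian B P) {s t : ℝ≥0} (hst : s ≤ t) :
    ∫⁻ ω, ‖B t ω - B s ω‖ₑ ^ 2 ∂P = ENNReal.ofReal (d * (t - s)) := by
  have h1 : ∀ ω, ‖B t ω - B s ω‖ₑ ^ 2 = ∑ k, ‖B t ω k - B s ω k‖ₑ ^ 2 := fun ω ↦ by
    rw [← ofReal_norm, ← ENNReal.ofReal_pow (norm_nonneg _), EuclideanSpace.norm_sq_eq,
      ENNReal.ofReal_sum_of_nonneg fun _ _ ↦ sq_nonneg _]
    refine Finset.sum_congr rfl fun k _ ↦ ?_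
    rw [ENNReal.ofReal_pow (norm_nonneg _), ofReal_norm, PiLp.sub_apply]
  simp_rw [h1]
  rw [lintegral_finsetSum']
  · simp_rw [lintegral_sq_brownian_increment (hB.coord _).toIsPreBrownianReal]
    have hst' : (s : ℝ) ≤ t := hst
    have : (nndist (t : ℝ) s : ENNReal) = ENNReal.ofReal (t - s) := by
      rw [← edist_nndist, edist_dist, Real.dist_eq, abs_of_nonneg (sub_nonneg.2 hst')]
    simp [this, ENNReal.ofReal_mul]
  · intro k _
    exact (((hB.coord k).aemeasurable t).sub ((hB.coord k).aemeasurable s)).enorm.pow_const 2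

end Noise

end IPLA

namespace IPLA

variable {dθ dx N : ℕ}

/-! ### The particle system as an equation with additive noise. -/

section ParticleSystem

variable {Ω : Type*} [MeasurableSpace Ω] {P : Measure Ω}

lemma sq_enorm_cloud (θ : Euc dθ) (X : Fin N → Euc dx) :
    ‖cloud θ X‖ₑ ^ 2 = ‖θ‖ₑ ^ 2 + ENNReal.ofReal (1 / (N : ℝ)) * ∑ i, ‖X i‖ₑ ^ 2 := by
  simp only [← ofReal_norm, ← ENNReal.ofReal_pow (norm_nonneg _)]
  rw [sq_norm_cloud, ENNReal.ofReal_add (by positivity) (by positivity),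
    ENNReal.ofReal_mul (by positivity), ENNReal.ofReal_sum_of_nonneg fun _ _ ↦ sq_nonneg _]

lemma sq_enorm_sqrt_smul {E : Type*} [NormedAddCommGroup E] [NormedSpace ℝ E] {c : ℝ}
    (hc : 0 ≤ c) (x : E) : ‖√c • x‖ₑ ^ 2 = ENNReal.ofReal c * ‖x‖ₑ ^ 2 := by
  rw [enorm_smul, mul_pow, Real.enorm_of_nonneg (Real.sqrt_nonneg _),
    ← ENNReal.ofReal_pow (Real.sqrt_nonneg _), Real.sq_sqrt hc]

/-- The noise of the particle system, as a process in `CloudSpace`. -/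
noncomputable def cloudNoise (B0 : ℝ≥0 → Ω → Euc dθ) (B : Fin N → ℝ≥0 → Ω → Euc dx) (s : ℝ)
    (ω : Ω) : CloudSpace dθ dx N :=
  cloud (√(2 / (N : ℝ)) • B0 s.toNNReal ω) fun i ↦ √2 • B i s.toNNReal ω

/-- The particle system, as a process in `CloudSpace`. -/
noncomputable def cloudProcess (θ : ℝ≥0 → Ω → Euc dθ) (X : Fin N → ℝ≥0 → Ω → Euc dx) (s : ℝ)
    (ω : Ω) : CloudSpace dθ dx N :=
  cloud (θ s.toNNReal ω) fun i ↦ X i s.toNNReal ω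

lemma aestronglyMeasurable_cloud {f : Ω → Euc dθ} {g : Fin N → Ω → Euc dx}
    (hf : AEMeasurable f P) (hg : ∀ i, AEMeasurable (g i) P) :
    AEStronglyMeasurable (fun ω ↦ cloud (f ω) fun i ↦ g i ω) P :=
  continuous_cloud.comp_aestronglyMeasurable
    (hf.prodMk (aemeasurable_pi_lambda (fun ω i ↦ g i ω) hg)).aestronglyMeasurable

variable {B0 : ℝ≥0 → Ω → Euc dθ} {B : Fin N → ℝ≥0 → Ω → Euc dx}

/-- Per unit time the `θ`-block has second moment `2 dθ / N`, and each of the `N` rescaled particles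
`2 dx / N`. -/
lemma eLpNorm_cloudNoise_sub_le (hN : 1 ≤ N) (hB : IsNoise B0 B P) {s t : ℝ} (hs : 0 ≤ s)
    (hst : s ≤ t) :
    eLpNorm (cloudNoise B0 B t - cloudNoise B0 B s) 2 P
      ≤ ENNReal.ofReal (√(2 * ((dθ : ℝ) / N + dx)) * √(t - s)) := by
  have hN' : (0 : ℝ) < N := by exact_mod_cast hN
  have hts : 0 ≤ t - s := sub_nonneg.2 hst
  rw [eLpNorm_two_le_ofReal_iff (by positivity), mul_pow, Real.sq_sqrt (by positivity),
    Real.sq_sqrt hts]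
  have h1 : ∀ ω, ‖(cloudNoise B0 B t - cloudNoise B0 B s) ω‖ₑ ^ 2
      = ENNReal.ofReal (2 / N) * ‖B0 t.toNNReal ω - B0 s.toNNReal ω‖ₑ ^ 2
        + ∑ i, ENNReal.ofReal (2 / N) * ‖B i t.toNNReal ω - B i s.toNNReal ω‖ₑ ^ 2 := fun ω ↦ by
    rw [Pi.sub_apply, cloudNoise, cloudNoise, cloud_sub, sq_enorm_cloud]
    simp only [← smul_sub]
    simp only [sq_enorm_sqrt_smul (show (0 : ℝ) ≤ 2 / N by positivity),
      sq_enorm_sqrt_smul (show (0 : ℝ) ≤ 2 by norm_num)]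
    rw [← Finset.mul_sum, ← Finset.mul_sum, ← mul_assoc, ← ENNReal.ofReal_mul (by positivity)]
    congr 3
    ring_nf
  have hst' : s.toNNReal ≤ t.toNNReal := Real.toNNReal_mono hst
  have hm : ∀ {d : ℕ} {b : ℝ≥0 → Ω → Euc d}, IsBrownian b P →
      AEMeasurable (fun ω ↦ ‖b t.toNNReal ω - b s.toNNReal ω‖ₑ ^ 2) P := fun hb ↦
    ((hb.aestronglyMeasurable _).sub (hb.aestronglyMeasurable _)).enorm.pow_const 2
  simp_rw [h1]
  rw [lintegral_add_left' ((hm hB.theta).const_mul _), lintegral_const_mul'' _ (hm hB.theta),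
    lintegral_finsetSum' _ fun i _ ↦ (hm (hB.particle i)).const_mul _]
  simp_rw [lintegral_const_mul'' _ (hm (hB.particle _)), (hB.particle _).lintegral_sq_increment hst']
  rw [hB.theta.lintegral_sq_increment hst', Real.coe_toNNReal _ hs,
    Real.coe_toNNReal _ (hs.trans hst), Finset.sum_const, Finset.card_univ, Fintype.card_fin,
    nsmul_eq_mul, ← ENNReal.ofReal_mul (by positivity), ← ENNReal.ofReal_mul (by positivity),
    ← ENNReal.ofReal_natCast N, ← ENNReal.ofReal_mul (by positivity),
    ← ENNReal.ofReal_add (by positivity) (by positivity)]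
  refine ENNReal.ofReal_le_ofReal (le_of_eq ?_)
  field_simp

variable {U : Joint dθ dx → ℝ} {θ0 : Ω → Euc dθ} {X0 : Fin N → Ω → Euc dx}
  {θ : ℝ≥0 → Ω → Euc dθ} {X : Fin N → ℝ≥0 → Ω → Euc dx}

lemma IsSolution.ae_continuous_cloudProcess (hsol : IsSolution U θ0 X0 B0 B P θ X) :
    ∀ᵐ ω ∂P, Continuous fun s ↦ cloudProcess θ X s ω := by
  filter_upwards [hsol.continuous_theta, ae_all_iff.2 hsol.continuous_particle] with ω h1 h2
  -- `Real.toNNReal` freezes the path at its initial value for negative times, giving continuity on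
  -- all of `ℝ`.
  exact continuous_cloud.comp ((h1.comp continuous_real_toNNReal).prodMk
    (continuous_pi fun i ↦ (h2 i).comp continuous_real_toNNReal))

lemma IsSolution.cloudProcess_eq (hN : 1 ≤ N) (hU : Continuous (cloudDrift (N := N) U))
    (hsol : IsSolution U θ0 X0 B0 B P θ X) :
    ∀ᵐ ω ∂P, ∀ t : ℝ, 0 ≤ t → cloudProcess θ X t ω = cloud (θ0 ω) (fun i ↦ X0 i ω)
      - (∫ u in (0 : ℝ)..t, cloudDrift U (cloudProcess θ X u ω)) + cloudNoise B0 B t ω := by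
  filter_upwards [hsol.ae_continuous_cloudProcess, hsol.eq_theta, ae_all_iff.2 hsol.eq_particle]
    with ω hc h1 h2 t ht
  have hi : IntervalIntegrable (fun u ↦ cloudDrift U (cloudProcess θ X u ω)) volume 0 t :=
    (hU.comp hc).intervalIntegrable _ _
  have hd : ∀ u, cloudDrift U (cloudProcess θ X u ω)
      = cloud ((1 / (N : ℝ)) • ∑ j, gradTheta U (θ u.toNNReal ω) (X j u.toNNReal ω))
        fun j ↦ gradX U (θ u.toNNReal ω) (X j u.toNNReal ω) := fun u ↦ cloudDrift_cloud hN _ _ _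
  refine CloudSpace.ext ?_ fun i ↦ ?_
  · have e := (WithLp.fstL 2 ℝ (Euc dθ) (PiLp 2 fun _ : Fin N ↦ Euc dx)).intervalIntegral_comp_comm
      hi
    simp only [hd, WithLp.fstL_apply, cloud_fst] at e
    have h := h1 t.toNNReal
    rw [Real.coe_toNNReal _ ht, e] at h
    simp only [hd, WithLp.add_fst, WithLp.sub_fst]
    exact h
  · have e := ((PiLp.proj (𝕜 := ℝ) 2 (fun _ : Fin N ↦ Euc dx) i).comp
      (WithLp.sndL 2 ℝ (Euc dθ) (PiLp 2 fun _ : Fin N ↦ Euc dx))).intervalIntegral_comp_comm hi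
    simp only [hd, ContinuousLinearMap.comp_apply, WithLp.sndL_apply, PiLp.proj_apply,
      cloud_snd, intervalIntegral.integral_smul] at e
    have h := congrArg (fun x ↦ (√(N : ℝ))⁻¹ • x) (h2 i t.toNNReal)
    simp only [Real.coe_toNNReal _ ht, smul_add, smul_sub] at h
    rw [e] at h
    simp only [hd, WithLp.add_snd, WithLp.sub_snd, PiLp.add_apply, PiLp.sub_apply]
    exact h

lemma IsNoise.aestronglyMeasurable_cloudNoise (hB : IsNoise B0 B P) (s : ℝ) :
    AEStronglyMeasurable (cloudNoise B0 B s) P := by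
  have h1 : AEMeasurable (fun ω ↦ √(2 / (N : ℝ)) • B0 s.toNNReal ω) P :=
    (hB.theta.aemeasurable s.toNNReal).const_smul √(2 / (N : ℝ))
  have h2 : ∀ i, AEMeasurable (fun ω ↦ √2 • B i s.toNNReal ω) P := fun i ↦
    ((hB.particle i).aemeasurable s.toNNReal).const_smul √2
  exact aestronglyMeasurable_cloud h1 h2

lemma IsNoise.ae_continuous_cloudNoise (hB : IsNoise B0 B P) :
    ∀ᵐ ω ∂P, Continuous fun s ↦ cloudNoise B0 B s ω := by
  filter_upwards [hB.theta.ae_continuous, ae_all_iff.2 fun i ↦ (hB.particle i).ae_continuous]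
    with ω h1 h2
  have h1' : Continuous fun s : ℝ ↦ √(2 / (N : ℝ)) • B0 s.toNNReal ω :=
    (h1.comp continuous_real_toNNReal).const_smul √(2 / (N : ℝ))
  have h2' : Continuous fun (s : ℝ) (i : Fin N) ↦ √2 • B i s.toNNReal ω :=
    continuous_pi fun i ↦ ((h2 i).comp continuous_real_toNNReal).const_smul √2
  exact continuous_cloud.comp (h1'.prodMk h2')

lemma IsSolution.aestronglyMeasurable_cloudProcess (hsol : IsSolution U θ0 X0 B0 B P θ X) (s : ℝ) :
    AEStronglyMeasurable (cloudProcess θ X s) P :=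
  aestronglyMeasurable_cloud (hsol.aemeasurable_theta _) fun i ↦ hsol.aemeasurable_particle i _

lemma IsSolution.isAdditiveNoiseSolution (hN : 1 ≤ N) (hU : Continuous (cloudDrift (N := N) U))
    (hB : IsNoise B0 B P) (hsol : IsSolution U θ0 X0 B0 B P θ X) :
    IsAdditiveNoiseSolution (cloudDrift U) (cloudNoise B0 B) (cloudProcess θ X)
      √(2 * ((dθ : ℝ) / N + dx)) P where
  aestronglyMeasurable_noise := hB.aestronglyMeasurable_cloudNoise
  aestronglyMeasurable := hsol.aestronglyMeasurable_cloudProcess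
  continuous_noise := hB.ae_continuous_cloudNoise
  continuous := hsol.ae_continuous_cloudProcess
  eLpNorm_noise_sub_le _ _ hs hst := eLpNorm_cloudNoise_sub_le hN hB hs hst
  eq := by
    filter_upwards [hsol.cloudProcess_eq hN hU, hsol.ae_continuous_cloudProcess]
      with ω h hc s t hs hst
    have hi : ∀ a b, IntervalIntegrable (fun u ↦ cloudDrift U (cloudProcess θ X u ω)) volume a b :=
      fun a b ↦ (hU.comp hc).intervalIntegrable a b
    rw [h t (hs.trans hst), h s hs, ← intervalIntegral.integral_add_adjacent_intervals (hi 0 s)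
      (hi s t)]
    abel

lemma cloudNoise_zero (hB : IsNoise B0 B P) : cloudNoise B0 B 0 =ᵐ[P] 0 := by
  filter_upwards [hB.theta.ae_eq_zero, ae_all_iff.2 fun i ↦ (hB.particle i).ae_eq_zero]
    with ω h1 h2
  refine CloudSpace.ext ?_ fun i ↦ ?_
  · simp [cloudNoise, h1]
  · simp [cloudNoise, h2]

lemma IsSolution.cloudProcess_zero (hN : 1 ≤ N) (hU : Continuous (cloudDrift (N := N) U))
    (hB : IsNoise B0 B P) (hsol : IsSolution U θ0 X0 B0 B P θ X) :
    cloudProcess θ X 0 =ᵐ[P] fun ω ↦ cloud (θ0 ω) fun i ↦ X0 i ω := by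
  filter_upwards [hsol.cloudProcess_eq hN hU, cloudNoise_zero hB] with ω h h0
  rw [h 0 le_rfl, h0]
  simp

lemma eLpNorm_initial_sub_le (h0 : IsInitial θ0 X0 B0 B P) [IsProbabilityMeasure P]
    (v : Joint dθ dx) {R : ℝ}
    (hR : ∫ ω, (‖θ0 ω - v.fst‖ ^ 2 + (1 / (N : ℝ)) * ∑ i, ‖X0 i ω - v.snd‖ ^ 2) ∂P ≤ R) :
    eLpNorm (fun ω ↦ cloud (θ0 ω) (fun i ↦ X0 i ω) - cloud v.fst fun _ ↦ v.snd) 2 P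
      ≤ ENNReal.ofReal √R := by
  have hnn : ∀ ω, 0 ≤ ‖θ0 ω - v.fst‖ ^ 2 + (1 / (N : ℝ)) * ∑ i, ‖X0 i ω - v.snd‖ ^ 2 :=
    fun ω ↦ by positivity
  have hR0 : 0 ≤ R := (integral_nonneg hnn).trans hR
  rw [eLpNorm_two_le_ofReal_iff (Real.sqrt_nonneg _), Real.sq_sqrt hR0]
  -- Without integrability the Bochner integral would default to zero and `hR` would carry no
  -- information.
  have hint : Integrable
      (fun ω ↦ ‖θ0 ω - v.fst‖ ^ 2 + (1 / (N : ℝ)) * ∑ i, ‖X0 i ω - v.snd‖ ^ 2) P := by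
    have hsq : ∀ {d : ℕ} {f : Ω → Euc d} (c : Euc d), MemLp f 2 P →
        Integrable (fun ω ↦ ‖f ω - c‖ ^ 2) P := fun c hf ↦ by
      have hfc := hf.sub (memLp_const c)
      exact (memLp_two_iff_integrable_sq_norm hfc.1).1 hfc
    exact (hsq _ h0.theta).add
      ((integrable_finsetSum _ fun i _ ↦ hsq _ (h0.particle i)).const_mul _)
  refine le_trans (le_of_eq ?_) (ENNReal.ofReal_le_ofReal hR)
  rw [ofReal_integral_eq_lintegral_ofReal hint (ae_of_all _ hnn)]
  refine lintegral_congr fun ω ↦ ?_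
  rw [cloud_sub, ← sq_norm_cloud, ENNReal.ofReal_pow (norm_nonneg _), ofReal_norm]

end ParticleSystem

/-! ### The Euler–Maruyama scheme in the rescaled space. -/

section Scheme

variable {Ω : Type*} {B0 : ℝ≥0 → Ω → Euc dθ} {B : Fin N → ℝ≥0 → Ω → Euc dx}
  {U : Joint dθ dx → ℝ} {θ0 : Ω → Euc dθ} {X0 : Fin N → Ω → Euc dx}

/-- The Euler–Maruyama scheme, as a process in `CloudSpace`. -/
noncomputable def cloudScheme (U : Joint dθ dx → ℝ) (θ0 : Ω → Euc dθ) (X0 : Fin N → Ω → Euc dx)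
    (B0 : ℝ≥0 → Ω → Euc dθ) (B : Fin N → ℝ≥0 → Ω → Euc dx) (γ : ℝ≥0) (n : ℕ) (ω : Ω) :
    CloudSpace dθ dx N :=
  cloud (scheme U θ0 X0 B0 B γ n ω).1 (scheme U θ0 X0 B0 B γ n ω).2

lemma cloudScheme_succ (hN : 1 ≤ N) {γ : ℝ≥0} (hγ : 0 < γ) (n : ℕ) (ω : Ω) :
    cloudScheme U θ0 X0 B0 B γ (n + 1) ω = cloudScheme U θ0 X0 B0 B γ n ω
      - (γ : ℝ) • cloudDrift U (cloudScheme U θ0 X0 B0 B γ n ω)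
      + (cloudNoise B0 B ((n + 1) * γ) ω - cloudNoise B0 B (n * γ) ω) := by
  have hγ' : √(γ : ℝ) ≠ 0 := (Real.sqrt_pos.2 hγ).ne'
  have e1 : ((n : ℝ) + 1) * γ = (((n : ℝ≥0) + 1) * γ : ℝ≥0) := by push_cast; rfl
  have e2 : (n : ℝ) * γ = ((n : ℝ≥0) * γ : ℝ≥0) := by push_cast; rfl
  have hsq : ∀ c : ℝ, 0 ≤ c → √(c * γ) * (√(γ : ℝ))⁻¹ = √c := fun c hc ↦ by
    rw [Real.sqrt_mul hc, mul_assoc, mul_inv_cancel₀ hγ', mul_one]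
  simp only [cloudScheme, cloudDrift_cloud hN, cloudNoise, cloud_sub, e1, e2, Real.toNNReal_coe,
    scheme, xi, smul_smul]
  refine CloudSpace.ext ?_ fun i ↦ ?_
  · have h2 : (2 : ℝ) * γ / N = 2 / N * γ := by ring
    simp only [cloud_fst, WithLp.add_fst, WithLp.sub_fst, WithLp.smul_fst, smul_smul]
    rw [h2, hsq _ (by positivity), smul_sub, mul_one_div]
  · simp only [cloud_snd, WithLp.add_snd, WithLp.sub_snd, WithLp.smul_snd, PiLp.add_apply,
      PiLp.sub_apply, PiLp.smul_apply]
    rw [hsq _ (by norm_num), smul_comm (γ : ℝ)]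
    simp only [smul_sub, smul_add]

end Scheme

end IPLA

/-! ### Conclusion: back to expectations, and the explicit constant. -/

lemma integrable_sq_norm_and_sqrt_integral_le {Ω E : Type*} [MeasurableSpace Ω] {P : Measure Ω}
    [NormedAddCommGroup E] {f : Ω → E} (hf : AEStronglyMeasurable f P) {c : ℝ} (hc : 0 ≤ c)
    (h : eLpNorm f 2 P ≤ ENNReal.ofReal c) :
    Integrable (fun ω ↦ ‖f ω‖ ^ 2) P ∧ √(∫ ω, ‖f ω‖ ^ 2 ∂P) ≤ c := by
  refine ⟨(memLp_two_iff_integrable_sq_norm hf).1 ⟨hf, h.trans_lt ENNReal.ofReal_lt_top⟩, ?_⟩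
  refine Real.sqrt_le_iff.2 ⟨hc, ?_⟩
  rw [integral_eq_lintegral_of_nonneg_ae (ae_of_all _ fun _ ↦ sq_nonneg _) (hf.norm.pow 2)]
  refine ENNReal.toReal_le_of_le_ofReal (sq_nonneg c) ?_
  simp_rw [ENNReal.ofReal_pow (norm_nonneg _), ofReal_norm]
  exact (eLpNorm_two_le_ofReal_iff hc).1 h

theorem proposition5 (L μ γ₀ R : ℝ) (hL : 0 < L) (hμ : 0 < μ)
    (hγ₀ : 0 < γ₀) (hγ₀' : γ₀ < min L⁻¹ (2 * μ⁻¹)) :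
    ∃ C₁ : ℝ, 0 < C₁ ∧
      ∀ (dθ dx : ℕ) (U : IPLA.Joint dθ dx → ℝ) (Lθ Lx : ℝ) (vstar : IPLA.Joint dθ dx),
        Differentiable ℝ U → 0 < Lθ → 0 < Lx →
        IPLA.LipschitzInBoth U Lθ Lx → IPLA.OverallLipschitz U L → IPLA.StronglyMonotone U μ →
        (∀ v, U vstar ≤ U v) →
      ∀ (N : ℕ), 1 ≤ N →
      ∀ (Ω : Type*) [MeasurableSpace Ω] (P : Measure Ω) [IsProbabilityMeasure P]
        (B0 : ℝ≥0 → Ω → IPLA.Euc dθ) (B : Fin N → ℝ≥0 → Ω → IPLA.Euc dx)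
        (θ0 : Ω → IPLA.Euc dθ) (X0 : Fin N → Ω → IPLA.Euc dx)
        (θ : ℝ≥0 → Ω → IPLA.Euc dθ) (X : Fin N → ℝ≥0 → Ω → IPLA.Euc dx),
        IPLA.IsNoise B0 B P → IPLA.IsInitial θ0 X0 B0 B P →
        (∫ ω, (‖θ0 ω - vstar.fst‖ ^ 2 + (1 / (N : ℝ)) * ∑ i, ‖X0 i ω - vstar.snd‖ ^ 2) ∂P ≤ R) →
        IPLA.IsSolution U θ0 X0 B0 B P θ X →
      ∀ (γ : ℝ≥0), 0 < γ → (γ : ℝ) < γ₀ → ∀ n : ℕ,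
        Integrable
          (fun ω ↦ ‖(IPLA.scheme U θ0 X0 B0 B γ n ω).1 - θ ((n : ℝ≥0) * γ) ω‖ ^ 2) P ∧
        √(∫ ω, ‖(IPLA.scheme U θ0 X0 B0 B γ n ω).1 - θ ((n : ℝ≥0) * γ) ω‖ ^ 2 ∂P)
          ≤ C₁ * (1 + √((dθ : ℝ) / N + dx)) * √(γ : ℝ) := by
  have hq : 0 < 1 - Real.exp (-(μ / 2)) := by
    rw [sub_pos, Real.exp_lt_one_iff]; linarith
  set c := (L / √μ + 1) * ((1 - Real.exp (-(μ / 2)))⁻¹ + 1) with hc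
  have hc0 : 0 < c := by positivity
  -- This is the Euler bound with `S = √R + c σ`, `σ = √2 √D` and `√γ ≤ √γ₀`, of the form `a + b
  -- √D`, which is at most `(a + b) (1 + √D)`.
  refine ⟨2 * L * (√γ₀ * L * √R + (√γ₀ * L * c + 1) * √2) / μ, by positivity, ?_⟩
  intro dθ dx U Lθ Lx vstar hU _ _ _ hLip hmono hmin N hN Ω _ P _ B0 B θ0 X0 θ X hB h0 hR hsol
    γ hγ hγγ₀ n
  have hA := IPLA.isMonotoneDrift_cloudDrift hN hL hμ hU hLip hmono
  have hAc := hA.continuous hL.le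
  have hz := IPLA.cloudDrift_eq_zero hN hmin
  have hZ := hsol.isAdditiveNoiseSolution hN hAc hB
  have hZ0 := hsol.cloudProcess_zero hN hAc hB
  set D : ℝ := (dθ : ℝ) / N + dx with hD
  set σ := √(2 * D) with hσ
  have hinit : eLpNorm (fun ω ↦ IPLA.cloudProcess θ X 0 ω
      - IPLA.cloud vstar.fst fun _ ↦ vstar.snd) 2 P ≤ ENNReal.ofReal √R := by
    refine le_trans (le_of_eq (eLpNorm_congr_ae ?_)) (IPLA.eLpNorm_initial_sub_le h0 vstar hR)
    filter_upwards [hZ0] with ω h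
    rw [h]
  have hmoment := fun t (ht : 0 ≤ t) ↦ hZ.eLpNorm_sub_const_le hA hL.le hμ (Real.sqrt_nonneg _) hz
    (Real.sqrt_nonneg R) hinit ht
  rw [← hc] at hmoment
  have hγ' : (0 : ℝ) < γ := hγ
  have hγL : (γ : ℝ) * L ≤ 1 := by
    have := hγγ₀.le.trans (hγ₀'.le.trans (min_le_left _ _))
    calc (γ : ℝ) * L ≤ L⁻¹ * L := by gcongr
      _ = 1 := inv_mul_cancel₀ hL.ne'
  have hγμ : μ * (γ : ℝ) ≤ 2 := by
    have h1 := hγγ₀.le.trans (hγ₀'.le.trans (min_le_right _ _))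
    calc μ * (γ : ℝ) ≤ μ * (2 * μ⁻¹) := by gcongr
      _ = 2 := by field_simp
  obtain ⟨hYm, herr⟩ := hZ.eLpNorm_euler_sub_le hA hL.le hμ (Real.sqrt_nonneg _) hz
    (by positivity) hmoment hγ' hγL hγμ (Y := IPLA.cloudScheme U θ0 X0 B0 B γ) hZ0.symm
    (fun n ↦ ae_of_all _ fun ω ↦ IPLA.cloudScheme_succ hN hγ n ω) n
  have htime : ((n : ℝ) * γ).toNNReal = (n : ℝ≥0) * γ := by
    rw [← NNReal.coe_natCast, ← NNReal.coe_mul, Real.toNNReal_coe]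
  have hfst : ∀ ω, (IPLA.scheme U θ0 X0 B0 B γ n ω).1 - θ ((n : ℝ≥0) * γ) ω
      = (IPLA.cloudScheme U θ0 X0 B0 B γ n ω - IPLA.cloudProcess θ X (n * γ) ω).fst := fun ω ↦ by
    rw [WithLp.sub_fst, IPLA.cloudProcess, htime]; rfl
  simp_rw [hfst]
  refine integrable_sq_norm_and_sqrt_integral_le
    ((WithLp.continuous_fst 2 _ _).comp_aestronglyMeasurable
      (hYm.sub (hZ.aestronglyMeasurable _))) (by positivity) ?_
  -- The `θ`-block is unscaled in the rescaled norm, so projecting onto it loses no factor of `N`.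
  refine (eLpNorm_mono fun ω ↦ WithLp.norm_fst_le _ _).trans
    (herr.trans (ENNReal.ofReal_le_ofReal ?_))
  gcongr
  have hsγ : √(γ : ℝ) ≤ √γ₀ := Real.sqrt_le_sqrt hγγ₀.le
  rw [div_mul_eq_mul_div]
  gcongr ?_ / μ
  have hσ' : σ = √2 * √D := by rw [hσ, Real.sqrt_mul (by norm_num)]
  have hsD := Real.sqrt_nonneg D
  have hsR := Real.sqrt_nonneg R
  calc 2 * (L * (√(γ : ℝ) * (L * (√R + c * σ)) + σ))
      ≤ 2 * (L * (√γ₀ * (L * (√R + c * σ)) + σ)) := by gcongr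
    _ = 2 * L * (√γ₀ * L * √R + (√γ₀ * L * c + 1) * √2 * √D) := by rw [hσ']; ring
    _ ≤ 2 * L * ((√γ₀ * L * √R + (√γ₀ * L * c + 1) * √2) * (1 + √D)) := by
        gcongr
        have h1 : 0 ≤ √γ₀ * L * √R * √D := by positivity
        have h2 : 0 ≤ (√γ₀ * L * c + 1) * √2 := by positivity
        linarith
    _ = _ := by ring
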